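/- **Setting.** All groups are finite. A group of order $n$ is given by its multiplication table, an $n\times n$ matrix with entries in $[n]$. The threshold $\alpha=\alpha(n)$ is a real number that may depend on the order $n$. An $\alpha$-decomposition of a group $G$ of order $n$ is a pair $(P_1,P_2)$ of subgroups such that $G=P_1P_2$, every prime dividing $|P_1|$ is greater than $\alpha(n)$, and every prime dividing $|P_2|$ is at most $\alpha(n)$. Two $\alpha$-decompositions $(P_1,P_2)$ of $G$ and $(Q_1,Q_2)$ of $H$ are isomorphic if some isomorphism $\phi:G\to H$ satisfies $\phi[P_1]=Q_1$ and $\phi[P_2]=Q_2$. A canonical form for $\alpha$-decompositions of solvable groups is a map $\mathrm{Can}$ that sends each $\alpha$-decomposition $(P_1,P_2)$ of a solvable group $G$ to some $(M,\psi[P_1],\psi[P_2])$, where $M$ is an $n\times n$ multiplication table with entries in $[n]$ and $\psi$ is an isomorphism from $G$ to the group of $M$, such that two $\alpha$-decompositions are isomorphic if and only if their images under $\mathrm{Can}$ are equal. A canonical form for solvable groups is a map that sends each solvable group $G$ to a multiplication table of a group isomorphic to $G$, such that two solvable groups are isomorphic if and only if their images are equal. A Sylow basis of $G$ consists of one Sylow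 $p$-subgroup $P_p$ for each prime $p$ dividing $n$ such that $P_pP_q=P_qP_p$ for all $p,q$. **Statement.** 1. Every solvable group of order $n$ has at least one and at most $n$ Sylow bases. 2. Let $\mathrm{Can}$ be a canonical form for $\alpha$-decompositions of solvable groups. For a solvable group $G$ of order $n$, let $\mathrm{Can}_{\mathbf{Grp}}(G)$ be the multiplication table in the lexicographically least of the canonical forms $\mathrm{Can}\bigl(\prod_{p>\alpha(n)}P_p,\ \prod_{p\le\alpha(n)}P_p\bigr)$, where $(P_p)_p$ runs over the Sylow bases of $G$. Then $\mathrm{Can}_{\mathbf{Grp}}$ is well defined and is a canonical form for solvable groups. 3. Computing $\mathrm{Can}_{\mathbf{Grp}}$ is deterministic polynomial-time Turing reducible to computing $\mathrm{Can}$. More precisely, there are one deterministic oracle program and one polynomial $q$ such that, for every $\alpha$ and every canonical form $\mathrm{Can}$ for $\alpha$-decompositions of solvable groups, the program with any oracle that answers each $\alpha$-decomposition of a solvable group with its canonical form under $\mathrm{Can}$, given the table of a solvable group $G$ of order $n$ and the number $\min(\max(\lfloor\alpha(n)\rfloor,0),n)$, outputs $\mathrm{Can}_{\mathbf{Grp}}(G)$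 in at most $q(n)$ steps. If, moreover, this number can be computed from $n$ in time polynomial in $n$ (for instance, if $\alpha$ is constant), then there are such a program, which may depend on $\alpha$ but not on $\mathrm{Can}$, and such a polynomial where the program is given the table of $G$ alone. -/

import Mathlib

namespace GroupCanon

/-! ### Groups given by multiplication tables -/

/-- A group given by its multiplication table: a group structure on `{0, …, order - 1}`. (The table
determines the identity and the inverses, so this is the same as a table of a group.) -/
structure TableGroup where
  order : ℕ
  group : Group (Fin order)

/-- The set of elements of a table group. It is a synonym of `Fin order`, so that the arithmetic
operations of `Fin` do not interfere with the group law. -/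
def TableGroup.El (G : TableGroup) : Type := Fin G.order

instance : CoeSort TableGroup Type := ⟨TableGroup.El⟩

instance (G : TableGroup) : Group G := G.group

instance (G : TableGroup) : Fintype G := inferInstanceAs (Fintype (Fin G.order))

/-- A table group together with an ordered pair of subgroups. -/
structure TablePair where
  grp : TableGroup
  fst : Subgroup grp
  snd : Subgroup grp

/-- Isomorphism of groups with a pair of subgroups: an isomorphism of the groups that maps the
first subgroup onto the first and the second onto the second. -/
def TablePair.Iso (D E : TablePair) : Prop :=
  ∃ φ : D.grp ≃* E.grp, D.fst.map φ.toMonoidHom = E.fst ∧ D.snd.map φ.toMonoidHom = E.snd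

/-! ### Words -/

/-- The word of a table group: its order, followed by its table, row by row. -/
def TableGroup.encode (G : TableGroup) : List ℕ :=
  G.order :: (List.finRange G.order).flatMap fun x =>
    (List.finRange G.order).map fun y => (G.group.mul x y).val

open Classical in
/-- The characteristic 0-1-vector of a subgroup. -/
noncomputable def charVector (G : TableGroup) (P : Subgroup G) : List ℕ :=
  (List.finRange G.order).map fun x => if (show G.El from x) ∈ P then 1 else 0

/-- The word of a table group with a pair of subgroups. -/
noncomputable def TablePair.encode (D : TablePair) : List ℕ :=
  D.grp.encode ++ charVector D.grp D.fst ++ charVector D.grp D.snd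

/-! ### Decompositions and Sylow bases -/

/-- `(P₁, P₂)` is an `a`-decomposition of the finite group `G`. -/
structure IsAlphaDecomp {G : Type*} [Group G] (a : ℝ) (P₁ P₂ : Subgroup G) : Prop where
  mul_eq : ∀ g : G, ∃ x ∈ P₁, ∃ y ∈ P₂, g = x * y
  large : ∀ p : ℕ, p.Prime → p ∣ Nat.card P₁ → a < p
  small : ∀ p : ℕ, p.Prime → p ∣ Nat.card P₂ → (p : ℝ) ≤ a

/-- A Sylow basis of a finite group: one Sylow `p`-subgroup for each prime `p` dividing the order,
any two of which permute. -/
@[ext]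
structure SylowBasis (G : Type*) [Group G] where
  sylow : ∀ p : (Nat.card G).primeFactors, Sylow p G
  permute : ∀ p q : (Nat.card G).primeFactors,
    {g : G | ∃ x ∈ sylow p, ∃ y ∈ sylow q, g = x * y} =
      {g : G | ∃ y ∈ sylow q, ∃ x ∈ sylow p, g = y * x}

/-- The product of the members of a Sylow basis that belong to primes greater than `a`. As the
members permute, their product is the subgroup that they generate. -/
def SylowBasis.large {G : Type*} [Group G] (B : SylowBasis G) (a : ℝ) : Subgroup G :=
  ⨆ p : (Nat.card G).primeFactors, ⨆ _ : a < ((p : ℕ) : ℝ), (B.sylow p : Subgroup G)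

/-- The product of the members of a Sylow basis that belong to primes at most `a`. -/
def SylowBasis.small {G : Type*} [Group G] (B : SylowBasis G) (a : ℝ) : Subgroup G :=
  ⨆ p : (Nat.card G).primeFactors, ⨆ _ : ((p : ℕ) : ℝ) ≤ a, (B.sylow p : Subgroup G)

/-! ### Canonical forms

The threshold `α` is a function of the order of the group. -/

/-- `D` is an `α`-decomposition of a solvable group. -/
def IsSolvableDecomp (α : ℕ → ℝ) (D : TablePair) : Prop :=
  Group.IsSolvable D.grp ∧ IsAlphaDecomp (α D.grp.order) D.fst D.snd

/-- `Can` is a canonical form for the `α`-decompositions of solvable groups: `Can (G, P₁, P₂)` is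
`(M, ψ[P₁], ψ[P₂])` for a multiplication table `M` and an isomorphism `ψ` from `G` to the group of
`M`, and two decompositions are isomorphic if and only if their canonical forms are equal. -/
def IsCanonicalDecomp (α : ℕ → ℝ) (Can : TablePair → TablePair) : Prop :=
  (∀ D, IsSolvableDecomp α D → D.Iso (Can D)) ∧
    ∀ D E, IsSolvableDecomp α D → IsSolvableDecomp α E → (D.Iso E ↔ Can D = Can E)

/-- `Can` is a canonical form for solvable groups. -/
def IsCanonicalSolvable (Can : TableGroup → TableGroup) : Prop :=
  (∀ G : TableGroup, Group.IsSolvable G → Nonempty (G ≃* Can G)) ∧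
    ∀ G H : TableGroup, Group.IsSolvable G → Group.IsSolvable H → (Nonempty (G ≃* H) ↔ Can G = Can H)

/-- The canonical forms of the `α`-decompositions of `G` that come from the Sylow bases of `G`. -/
def sylowForms (α : ℕ → ℝ) (Can : TablePair → TablePair) (G : TableGroup) : Set TablePair :=
  Set.range fun B : SylowBasis G => Can ⟨G, B.large (α G.order), B.small (α G.order)⟩

/-- `D` is the lexicographically least member of `S` (words are compared lexicographically). -/
def IsLexLeast (S : Set TablePair) (D : TablePair) : Prop :=
  D ∈ S ∧ ∀ E ∈ S, D.encode ≤ E.encode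

/-- `CanGrp G` is the multiplication table of the lexicographically least canonical form of the
`α`-decompositions that come from the Sylow bases of `G`, for every solvable `G`. -/
def IsLexLeastTable (α : ℕ → ℝ) (Can : TablePair → TablePair) (CanGrp : TableGroup → TableGroup) :
    Prop :=
  ∀ G : TableGroup, Group.IsSolvable G → ∃ D, IsLexLeast (sylowForms α Can G) D ∧ CanGrp G = D.grp

/-! ### Deterministic oracle programs

Programs of a random access machine with registers and arrays of natural numbers, each indexed by
a constant of the program, with the instructions addition, truncated subtraction, indirect access
and oracle query. Every instruction and every test costs one step; a query costs in addition the
lengths of the question and of the answer. There is no multiplication, so that `t` steps can only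
double a number `t` times and running times agree with those of oracle Turing machines up to a
polynomial. -/

/-- The contents of the registers and of the arrays. -/
structure Store where
  reg : ℕ → ℕ
  arr : ℕ → ℕ → ℕ

def Store.setReg (s : Store) (x v : ℕ) : Store :=
  { s with reg := Function.update s.reg x v }

def Store.setArr (s : Store) (a i v : ℕ) : Store :=
  { s with arr := Function.update s.arr a (Function.update (s.arr a) i v) }

/-- The first `len` entries of array `a`. -/
def Store.word (s : Store) (a len : ℕ) : List ℕ := (List.range len).map (s.arr a)

/-- Write the word `w` to the beginning of array `a`. -/
def Store.setWord (s : Store) (a : ℕ) (w : List ℕ) : Store :=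
  { s with arr := Function.update s.arr a fun i => w.getD i (s.arr a i) }

/-- The store in which array `0` holds the word `w` and register `0` its length; all other
registers and array entries are zero. -/
def Store.init (w : List ℕ) : Store where
  reg := fun x => if x = 0 then w.length else 0
  arr := fun a i => if a = 0 then w.getD i 0 else 0

/-- Oracle programs. -/
inductive Prog where
  | skip
  | const (x k : ℕ)         -- register x := k
  | add (x y z : ℕ)         -- register x := register y + register z
  | sub (x y z : ℕ)         -- register x := register y - register z, truncated at 0
  | load (x a y : ℕ)        -- register x := entry of array a at the index in register y
  | store (a x y : ℕ)       -- entry of array a at the index in register x := register y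
  | query (a x b y : ℕ)     -- ask for the first (register x) entries of array a; write the
                            -- answer to array b and its length to register y
  | seq (c d : Prog)
  | ite (x : ℕ) (c d : Prog)  -- if register x is not 0 then c else d
  | loop (x : ℕ) (c : Prog)   -- while register x is not 0 do c

/-- `Exec O c s s' t`: with the oracle `O`, the program `c` started in the store `s` halts in the
store `s'` after `t` steps. -/
inductive Exec (O : List ℕ → List ℕ) : Prog → Store → Store → ℕ → Prop
  | skip (s : Store) : Exec O .skip s s 1
  | const (s : Store) (x k : ℕ) : Exec O (.const x k) s (s.setReg x k) 1
  | add (s : Store) (x y z : ℕ) : Exec O (.add x y z) s (s.setReg x (s.reg y + s.reg z)) 1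
  | sub (s : Store) (x y z : ℕ) : Exec O (.sub x y z) s (s.setReg x (s.reg y - s.reg z)) 1
  | load (s : Store) (x a y : ℕ) : Exec O (.load x a y) s (s.setReg x (s.arr a (s.reg y))) 1
  | store (s : Store) (a x y : ℕ) : Exec O (.store a x y) s (s.setArr a (s.reg x) (s.reg y)) 1
  | query (s : Store) (a x b y : ℕ) (w : List ℕ) (hw : w = O (s.word a (s.reg x))) :
      Exec O (.query a x b y) s ((s.setWord b w).setReg y w.length) (1 + s.reg x + w.length)
  | seq {c d : Prog} {s s' s'' : Store} {t t' : ℕ} :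
      Exec O c s s' t → Exec O d s' s'' t' → Exec O (.seq c d) s s'' (t + t')
  | ite_true {x : ℕ} {c d : Prog} {s s' : Store} {t : ℕ} :
      s.reg x ≠ 0 → Exec O c s s' t → Exec O (.ite x c d) s s' (1 + t)
  | ite_false {x : ℕ} {c d : Prog} {s s' : Store} {t : ℕ} :
      s.reg x = 0 → Exec O d s s' t → Exec O (.ite x c d) s s' (1 + t)
  | loop_true {x : ℕ} {c : Prog} {s s' s'' : Store} {t t' : ℕ} :
      s.reg x ≠ 0 → Exec O c s s' t → Exec O (.loop x c) s' s'' t' →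
        Exec O (.loop x c) s s'' (1 + t + t')
  | loop_false {x : ℕ} {c : Prog} {s : Store} :
      s.reg x = 0 → Exec O (.loop x c) s s 1

/-- With the oracle `O`, the program `c` turns the input word `v` into the output word `w` in at
most `T` steps. The output is found where the input was: in array `0`, its length in
register `0`. -/
def ComputesWithin (O : List ℕ → List ℕ) (c : Prog) (v w : List ℕ) (T : ℕ) : Prop :=
  ∃ s t, Exec O c (Store.init v) s t ∧ s.word 0 (s.reg 0) = w ∧ t ≤ T

/-- The oracle `O` answers each `α`-decomposition of a solvable group with its canonical form. Its
answers to all other questions are arbitrary. -/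
def IsCanOracle (α : ℕ → ℝ) (Can : TablePair → TablePair) (O : List ℕ → List ℕ) : Prop :=
  ∀ D, IsSolvableDecomp α D → O D.encode = (Can D).encode

/-- The program `c`, given the table of a solvable group `G` of order `n`, followed by the word
`extra n`, and any oracle for the canonical form `Can` of `α`-decompositions, outputs the table
`CanGrp G` in at most `T n` steps. -/
def ReducesTo (α : ℕ → ℝ) (Can : TablePair → TablePair) (CanGrp : TableGroup → TableGroup)
    (extra : ℕ → List ℕ) (c : Prog) (T : ℕ → ℕ) : Prop :=
  ∀ O, IsCanOracle α Can O → ∀ G : TableGroup, Group.IsSolvable G →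
    ComputesWithin O c (G.encode ++ extra G.order) (CanGrp G).encode (T G.order)

/-- The integer part of the threshold, cut off at `n`: a prime divisor of `n` is at most `α n` if
and only if it is at most this number. -/
noncomputable def threshold (α : ℕ → ℝ) (n : ℕ) : ℕ := min ⌊α n⌋₊ n

/-- The threshold can be computed from `n` in time polynomial in `n` (as the program works with
every oracle, oracles are of no help). -/
def IsPolyTimeThreshold (α : ℕ → ℝ) : Prop :=
  ∃ (c : Prog) (q : Polynomial ℕ), ∀ (O : List ℕ → List ℕ) (n : ℕ), 1 ≤ n →
    ComputesWithin O c [n] [threshold α n] (q.eval n)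

end GroupCanon

open GroupCanon

/-!
All `α`-decompositions `(P₁, P₂)` of a solvable group `G` are conjugate
(`IsAlphaDecomp.exists_conj`): `P₁` and `P₂` are Hall subgroups for complementary sets of primes, so
by Hall's theorem the first members of two decompositions may be assumed equal; then the second
members are conjugate by an element of `G = P₁ * P₂`, hence by one of `P₁`. Therefore the
decompositions that come from the Sylow bases of `G` all have the same canonical form, which is also
the canonical form of every other `α`-decomposition of `G` (`IsCanonicalDecomp.sylowForms_eq`). The
lexicographically least form is this common one, and the claims on canonical forms follow.

Hall's theorem (`exists_isHall_and_dominates`) is proved by induction along an abelian normal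
`p`-subgroup, with the Schur–Zassenhaus theorem for existence and the vanishing of a crossed
homomorphism for conjugacy. A Sylow basis is obtained by intersecting Hall `p'`-subgroups, and it is
determined by them; as they are conjugate, there are at most as many for each `p` as the `p`-part of
the order, and the product of these numbers bounds the number of Sylow bases.

The program has to find one `α`-decomposition and to ask one question. By Hall's theorem, a
`π`-subgroup `H` is a Hall `π`-subgroup as soon as no element `g` outside `H` generates a
`π`-subgroup together with `H`, so that one pass through the elements of `G` that extends `H`
whenever possible finds one. The test for being a `π`-subgroup is that a certain set of elements is
avoided: for the primes above the threshold, the nontrivial elements of order at most the threshold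
(`isPi_lt_iff_avoids`); for the other primes, the conjugates of the nontrivial elements of the Hall
subgroup found before (`isPi_not_iff_avoids`). Running times are bounded by the rules of a program
logic for `Exec`, see `Runs`. If the threshold is to be computed, the program for it is run after
the input has been moved out of its reach (`Exec.transfer`).
-/

namespace GroupCanon

universe u

/-! ### Hall subgroups of solvable groups -/

/-- Every prime divisor of `n` satisfies `π`. -/
def IsPi (π : ℕ → Prop) (n : ℕ) : Prop := ∀ p : ℕ, p.Prime → p ∣ n → π p

theorem IsPi.of_dvd {π : ℕ → Prop} {m n : ℕ} (h : IsPi π n) (hmn : m ∣ n) : IsPi π m :=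
  fun p hp hd => h p hp (hd.trans hmn)

theorem IsPi.mul {π : ℕ → Prop} {m n : ℕ} (hm : IsPi π m) (hn : IsPi π n) : IsPi π (m * n) :=
  fun p hp hd => (hp.dvd_mul.1 hd).elim (hm p hp) (hn p hp)

theorem IsPi.coprime {π : ℕ → Prop} {m n : ℕ} (hm : IsPi π m) (hn : IsPi (fun p => ¬ π p) n) :
    m.Coprime n :=
  Nat.coprime_of_dvd fun p hp h1 h2 => hn p hp h2 (hm p hp h1)

/-- `H` is a Hall `π`-subgroup: the primes dividing its order satisfy `π`, those dividing its index
do not. -/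
structure IsHall {G : Type*} [Group G] (π : ℕ → Prop) (H : Subgroup G) : Prop where
  card : IsPi π (Nat.card H)
  index : IsPi (fun p => ¬ π p) H.index

section Hall

set_option linter.unusedSectionVars false

variable {G : Type u} [Group G] [Finite G] {π : ℕ → Prop}

theorem IsHall.card_dvd {H U : Subgroup G} (hH : IsHall π H) (hU : IsPi π (Nat.card U)) :
    Nat.card U ∣ Nat.card H := by
  have h := U.card_subgroup_dvd_card
  rw [← H.card_mul_index] at h
  exact (hU.coprime hH.index).dvd_of_dvd_mul_right h

theorem IsHall.eq_of_le {H U : Subgroup G} (hH : IsHall π H) (hU : IsPi π (Nat.card U))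
    (hle : H ≤ U) : H = U :=
  Subgroup.eq_of_le_of_card_ge hle (Nat.le_of_dvd Nat.card_pos (hH.card_dvd hU))

theorem IsHall.of_card_eq {H K : Subgroup G} (hH : IsHall π H) (h : Nat.card K = Nat.card H) :
    IsHall π K := by
  refine ⟨h ▸ hH.card, ?_⟩
  have h1 := H.card_mul_index
  rw [← K.card_mul_index, h] at h1
  exact Nat.eq_of_mul_eq_mul_left Nat.card_pos h1 ▸ hH.index

/-- The conjugacy part of the Schur–Zassenhaus theorem for an abelian normal subgroup `N`, in the
form in which a subgroup `U` of `N * H` of order prime to that of `N` is conjugated into a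
complement `H`. The `N`-components of the elements of `U` form a crossed homomorphism, which is
principal: a root of the product of its values provides the conjugating element. -/
theorem exists_conj_mem_of_abelian_normal (N H U : Subgroup G) [N.Normal]
    (hcomm : ∀ x ∈ N, ∀ y ∈ N, x * y = y * x) (hNH : ∀ x ∈ N, x ∈ H → x = 1)
    (hcop : (Nat.card N).Coprime (Nat.card U)) (hU : ∀ u ∈ U, ∃ x ∈ N, ∃ h ∈ H, u = x * h) :
    ∃ c : G, ∀ u ∈ U, c⁻¹ * u * c ∈ H := by
  classical
  let : CommGroup N := { mul_comm := fun x y => Subtype.ext (hcomm x x.2 y y.2) }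
  let := Fintype.ofFinite U
  have hU' : ∀ u : U, ∃ x : N, ∃ h ∈ H, (u : G) = x * h := fun u => by
    obtain ⟨x, hx, h, hh, e⟩ := hU u u.2
    exact ⟨⟨x, hx⟩, h, hh, e⟩
  choose n h hh hn using hU'
  have huniq : ∀ (x y : N) (a b : G), a ∈ H → b ∈ H → (x : G) * a = y * b → x = y := by
    intro x y a b ha hb e
    have e1 : ((y⁻¹ * x : N) : G) = b * a⁻¹ := by
      push_cast
      rw [eq_mul_inv_iff_mul_eq, mul_assoc, e, inv_mul_cancel_left]
    have e2 := hNH _ (y⁻¹ * x).2 (e1 ▸ H.mul_mem hb (H.inv_mem ha))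
    have e3 : y⁻¹ * x = 1 := Subtype.ext e2
    exact (inv_mul_eq_one.1 e3).symm
  have hcocycle : ∀ u v : U, n (u * v) = n u * MulAut.conjNormal (u : G) (n v) := by
    intro u v
    refine huniq _ _ (h (u * v)) (h u * h v) (hh _) (H.mul_mem (hh _) (hh _)) ?_
    rw [← hn]
    have hy : h u * n v * (h u)⁻¹ ∈ N := Subgroup.Normal.conj_mem inferInstance _ (n v).2 _
    have e : (u : G) * n v * (u : G)⁻¹ = h u * n v * (h u)⁻¹ := by
      have := hcomm _ (n u).2 _ hy
      rw [hn u, mul_inv_rev]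
      calc (n u : G) * h u * n v * ((h u)⁻¹ * (n u : G)⁻¹)
          = (n u : G) * (h u * n v * (h u)⁻¹) * (n u : G)⁻¹ := by group
        _ = _ := by rw [this]; group
    push_cast
    rw [MulAut.conjNormal_apply, e, hn u, hn v]
    group
  obtain ⟨c, hc⟩ := (powCoprime hcop).surjective (∏ v : U, n v)
  rw [powCoprime_apply] at hc
  have hfix : ∀ u : U, c = n u * MulAut.conjNormal (u : G) c := by
    intro u
    apply (powCoprime hcop).injective
    rw [powCoprime_apply, powCoprime_apply, mul_pow, ← map_pow, hc, map_prod]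
    have e1 : ∏ v : U, n v = ∏ v : U, n (u * v) := (Equiv.prod_comp (Equiv.mulLeft u) n).symm
    conv_lhs => rw [e1]
    simp_rw [hcocycle]
    rw [Finset.prod_mul_distrib, Finset.prod_const, Finset.card_univ, Nat.card_eq_fintype_card]
  refine ⟨c, fun u hu => ?_⟩
  have e1 := congrArg (Subtype.val) (hfix ⟨u, hu⟩)
  have e2 := hn ⟨u, hu⟩
  have hy : u * c * u⁻¹ ∈ N := Subgroup.Normal.conj_mem inferInstance _ c.2 _
  have e3 := hcomm _ hy _ (N.inv_mem c.2)
  push_cast at e1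
  rw [MulAut.conjNormal_apply] at e1
  simp only at e1 e2
  have e4 : (c : G)⁻¹ * u * c = h ⟨u, hu⟩ := by
    calc (c : G)⁻¹ * u * c = (c : G)⁻¹ * (u * c * u⁻¹) * u := by group
      _ = u * c * u⁻¹ * (c : G)⁻¹ * u := by rw [e3]
      _ = u * c * u⁻¹ * (n ⟨u, hu⟩ * (u * c * u⁻¹))⁻¹ * u := by rw [← e1]
      _ = (n ⟨u, hu⟩ : G)⁻¹ * u := by group
      _ = h ⟨u, hu⟩ := by rw [inv_mul_eq_iff_eq_mul]; exact e2
  rw [e4]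
  exact hh _

/-- A nontrivial finite solvable group has a nontrivial abelian normal `p`-subgroup: the elements of
order dividing `p` in the last nontrivial member of the derived series. -/
theorem exists_abelian_normal_pSubgroup (G : Type u) [Group G] [Finite G] [Group.IsSolvable G]
    [Nontrivial G] : ∃ (p : ℕ) (N : Subgroup G), N.Normal ∧ N ≠ ⊥ ∧ IsPi (· = p) (Nat.card N) ∧
      ∀ x ∈ N, ∀ y ∈ N, x * y = y * x := by
  classical
  have hs : ∃ n, derivedSeries G n = ⊥ := Group.IsSolvable.solvable
  obtain ⟨m, hm⟩ : ∃ m, Nat.find hs = m + 1 := by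
    refine Nat.exists_eq_succ_of_ne_zero fun h => ?_
    have := Nat.find_spec hs
    rw [h, derivedSeries_zero] at this
    exact top_ne_bot this
  have h1 : derivedSeries G (m + 1) = ⊥ := hm ▸ Nat.find_spec hs
  have h2 : derivedSeries G m ≠ ⊥ := Nat.find_min hs (by omega)
  set A := derivedSeries G m with hA
  have : A.Normal := derivedSeries_normal G m
  have hcomm : ∀ x ∈ A, ∀ y ∈ A, x * y = y * x := by
    rw [derivedSeries_succ, Subgroup.commutator_eq_bot_iff_le_centralizer] at h1
    intro x hx y hy
    exact (Subgroup.mem_centralizer_iff.1 (h1 hx) y hy).symm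
  have hcard : Nat.card A ≠ 1 := fun h => h2 (Subgroup.card_eq_one.1 h)
  have hp := Nat.minFac_prime hcard
  obtain ⟨a, ha⟩ := exists_prime_orderOf_dvd_card' (G := A) (Nat.card A).minFac (hp := ⟨hp⟩)
    (Nat.minFac_dvd _)
  set p := (Nat.card A).minFac
  let N : Subgroup G :=
    { carrier := {x | x ∈ A ∧ x ^ p = 1}
      one_mem' := ⟨A.one_mem, one_pow _⟩
      mul_mem' := fun {x y} hx hy => ⟨A.mul_mem hx.1 hy.1, by
        rw [(show Commute x y from hcomm _ hx.1 _ hy.1).mul_pow, hx.2, hy.2, one_mul]⟩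
      inv_mem' := fun {x} hx => ⟨A.inv_mem hx.1, by rw [inv_pow, hx.2, inv_one]⟩ }
  refine ⟨p, N, ⟨fun x hx g => ⟨Subgroup.Normal.conj_mem inferInstance _ hx.1 _, ?_⟩⟩, ?_, ?_,
    fun x hx y hy => hcomm x hx.1 y hy.1⟩
  · rw [conj_pow, hx.2, mul_one, mul_inv_cancel]
  · intro h
    have : (a : G) ∈ N := ⟨a.2, by rw [← ha]; exact_mod_cast congrArg Subtype.val (pow_orderOf_eq_one a)⟩
    rw [h, Subgroup.mem_bot] at this
    have ha1 : a = 1 := Subtype.ext this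
    rw [ha1, orderOf_one] at ha
    exact hp.one_lt.ne ha
  · intro q hq hd
    obtain ⟨b, hb⟩ := exists_prime_orderOf_dvd_card' (G := N) q (hp := ⟨hq⟩) hd
    have : b ^ p = 1 := Subtype.ext (by push_cast; exact b.2.2)
    have := orderOf_dvd_of_pow_eq_one this
    rw [hb] at this
    exact (Nat.prime_dvd_prime_iff_eq hq hp).1 this

theorem card_comap_mk (N : Subgroup G) [N.Normal] (H : Subgroup (G ⧸ N)) :
    Nat.card (H.comap (QuotientGroup.mk' N)) = Nat.card N * Nat.card H := by
  have h1 := (H.comap (QuotientGroup.mk' N)).card_mul_index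
  rw [Subgroup.index_comap_of_surjective H (QuotientGroup.mk'_surjective N),
    ← N.card_mul_index, Subgroup.index_eq_card N, ← H.card_mul_index, ← mul_assoc] at h1
  exact Nat.eq_of_mul_eq_mul_right (Nat.pos_of_ne_zero Subgroup.index_ne_zero_of_finite) h1

theorem IsHall.map_mk {H : Subgroup G} (hH : IsHall π H) (N : Subgroup G) [N.Normal] :
    IsHall π (H.map (QuotientGroup.mk' N)) :=
  ⟨hH.card.of_dvd (Subgroup.card_map_dvd _ _),
    hH.index.of_dvd (Subgroup.index_map_dvd _ (QuotientGroup.mk'_surjective N))⟩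

/-- Hall's theorem, by induction on the order. For an abelian normal `p`-subgroup `N`, the quotient
provides a subgroup whose image is a Hall `π`-subgroup of `G ⧸ N`. If `p` is in `π`, it contains `N`
and is a Hall `π`-subgroup of `G`; otherwise a complement of `N` in it is one. -/
theorem exists_isHall_and_dominates (π : ℕ → Prop) (m : ℕ) : ∀ (G : Type u) [Group G] [Finite G]
    [Group.IsSolvable G], Nat.card G = m → (∃ H : Subgroup G, IsHall π H) ∧
      ∀ H U : Subgroup G, IsHall π H → IsPi π (Nat.card U) → ∃ g : G, ∀ u ∈ U, g * u * g⁻¹ ∈ H := by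
  induction m using Nat.strong_induction_on with
  | _ m ih =>
  intro G _ _ _ hm
  rcases subsingleton_or_nontrivial G with hG | hG
  · refine ⟨⟨⊥, ?_, ?_⟩, fun H U _ _ => ⟨1, fun u _ => ?_⟩⟩
    · rw [Subgroup.card_bot]
      exact fun p hp hd => absurd (Nat.dvd_one.1 hd) hp.ne_one
    · rw [Subgroup.index_bot, Nat.card_of_subsingleton (1 : G)]
      exact fun p hp hd => absurd (Nat.dvd_one.1 hd) hp.ne_one
    · rw [Subsingleton.elim (1 * u * 1⁻¹) 1]
      exact H.one_mem
  obtain ⟨p, N, hN, hbot, hNp, hcomm⟩ := exists_abelian_normal_pSubgroup G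
  have hN1 : 1 < Nat.card N := by
    have : Nat.card N ≠ 1 := fun h => hbot (Subgroup.card_eq_one.1 h)
    have : 0 < Nat.card N := Nat.card_pos
    omega
  have hlt : Nat.card (G ⧸ N) < m := by
    rw [← hm, Subgroup.card_eq_card_quotient_mul_card_subgroup N]
    exact (Nat.lt_mul_iff_one_lt_right Nat.card_pos).2 hN1
  obtain ⟨⟨Hb, hHb⟩, hdom⟩ := ih _ hlt (G ⧸ N) rfl
  have hindex := Subgroup.index_comap_of_surjective Hb (QuotientGroup.mk'_surjective N)
  constructor
  · by_cases hπ : π p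
    · refine ⟨Hb.comap (QuotientGroup.mk' N), ?_, hindex ▸ hHb.index⟩
      rw [card_comap_mk]
      exact IsPi.mul (fun q hq hd => (hNp q hq hd : q = p) ▸ hπ) hHb.card
    · have hNp' : IsPi (fun q => ¬ π q) (Nat.card N) :=
        fun q hq hd => (hNp q hq hd : q = p) ▸ hπ
      set M := Hb.comap (QuotientGroup.mk' N) with hM
      have hNM : N ≤ M := fun x hx => by
        rw [hM, Subgroup.mem_comap, QuotientGroup.mk'_apply, (QuotientGroup.eq_one_iff x).2 hx]
        exact Hb.one_mem
      have hcM : Nat.card M = Nat.card N * Nat.card Hb := card_comap_mk N Hb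
      have hcN : Nat.card (N.subgroupOf M) = Nat.card N :=
        Nat.card_congr (Subgroup.subgroupOfEquivOfLe hNM).toEquiv
      have hiN : (N.subgroupOf M).index = Nat.card Hb := by
        have := (N.subgroupOf M).card_mul_index
        rw [hcM, hcN] at this
        exact Nat.eq_of_mul_eq_mul_left Nat.card_pos this
      obtain ⟨K, hK⟩ := Subgroup.exists_right_complement'_of_coprime (N := N.subgroupOf M)
        (by rw [hcN, hiN]; exact (hHb.card.coprime hNp').symm)
      have hcK : Nat.card (K.map M.subtype) = Nat.card Hb := by
        rw [Subgroup.card_map_of_injective M.subtype_injective]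
        have := hK.card_mul_card
        rw [hcM, hcN] at this
        exact Nat.eq_of_mul_eq_mul_left Nat.card_pos this
      refine ⟨K.map M.subtype, hcK ▸ hHb.card, ?_⟩
      have h1 := (K.map M.subtype).card_mul_index
      rw [← M.card_mul_index, hcK, hcM, hindex, mul_comm (Nat.card N), mul_assoc] at h1
      rw [Nat.eq_of_mul_eq_mul_left Nat.card_pos h1]
      exact hNp'.mul hHb.index
  · intro H U hH hU
    obtain ⟨gb, hgb⟩ := hdom _ (U.map (QuotientGroup.mk' N)) (hH.map_mk N)
      (hU.of_dvd (Subgroup.card_map_dvd _ _))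
    obtain ⟨g, rfl⟩ := QuotientGroup.mk'_surjective N gb
    have hg : ∀ u ∈ U, ∃ x ∈ N, ∃ h ∈ H, g * u * g⁻¹ = x * h := by
      intro u hu
      obtain ⟨h, hh, e⟩ := hgb _ (Subgroup.mem_map_of_mem _ hu)
      rw [← map_mul, ← map_inv, ← map_mul, QuotientGroup.mk'_apply, QuotientGroup.mk'_apply,
        QuotientGroup.eq] at e
      refine ⟨h * (h⁻¹ * (g * u * g⁻¹)) * h⁻¹, Subgroup.Normal.conj_mem hN _ e h, h, hh, by group⟩
    by_cases hπ : π p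
    · have hNH : N ≤ H := by
        have h1 : IsPi π (Nat.card ((H.map (QuotientGroup.mk' N)).comap (QuotientGroup.mk' N))) := by
          rw [card_comap_mk]
          exact IsPi.mul (fun q hq hd => (hNp q hq hd : q = p) ▸ hπ)
            (hH.card.of_dvd (Subgroup.card_map_dvd _ _))
        rw [hH.eq_of_le h1 (Subgroup.le_comap_map _ _)]
        intro x hx
        rw [Subgroup.mem_comap, QuotientGroup.mk'_apply, (QuotientGroup.eq_one_iff x).2 hx]
        exact Subgroup.one_mem _
      refine ⟨g, fun u hu => ?_⟩
      obtain ⟨x, hx, h, hh, e⟩ := hg u hu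
      exact e ▸ H.mul_mem (hNH hx) hh
    · have hNp' : IsPi (fun q => ¬ π q) (Nat.card N) :=
        fun q hq hd => (hNp q hq hd : q = p) ▸ hπ
      have hcU : Nat.card (U.map (MulAut.conj g).toMonoidHom) = Nat.card U :=
        Subgroup.card_map_of_injective (MulAut.conj g).injective
      obtain ⟨c, hc⟩ := exists_conj_mem_of_abelian_normal N H (U.map (MulAut.conj g).toMonoidHom)
        hcomm (fun x hx hx' => by
          have h1 := Subgroup.orderOf_dvd_natCard N hx
          have h2 := Subgroup.orderOf_dvd_natCard H hx'
          exact orderOf_eq_one_iff.1 (Nat.eq_one_of_dvd_coprimes (hH.card.coprime hNp') h2 h1))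
        (by rw [hcU]; exact (hU.coprime hNp').symm)
        (by rintro _ ⟨u, hu, rfl⟩; exact hg u hu)
      refine ⟨c⁻¹ * g, fun u hu => ?_⟩
      have := hc _ (Subgroup.mem_map_of_mem _ hu)
      convert this using 1
      simp [mul_assoc]

variable [Group.IsSolvable G]

/-- Hall's theorem, existence. -/
theorem exists_isHall (π : ℕ → Prop) : ∃ H : Subgroup G, IsHall π H :=
  (exists_isHall_and_dominates π _ G rfl).1

/-- Hall's theorem: a Hall `π`-subgroup contains a conjugate of every `π`-subgroup. -/
theorem IsHall.exists_conj_mem {H U : Subgroup G} (hH : IsHall π H) (hU : IsPi π (Nat.card U)) :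
    ∃ g : G, ∀ u ∈ U, g * u * g⁻¹ ∈ H :=
  (exists_isHall_and_dominates π _ G rfl).2 H U hH hU

theorem IsHall.exists_map_conj_eq {H K : Subgroup G} (hH : IsHall π H) (hK : IsHall π K) :
    ∃ g : G, K.map (MulAut.conj g).toMonoidHom = H := by
  obtain ⟨g, hg⟩ := hH.exists_conj_mem hK.card
  have hc : Nat.card (K.map (MulAut.conj g).toMonoidHom) = Nat.card K :=
    Subgroup.card_map_of_injective (MulAut.conj g).injective
  refine ⟨g, (hK.of_card_eq hc).eq_of_le hH.card ?_⟩
  rintro _ ⟨u, hu, rfl⟩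
  exact hg u hu

end Hall

/-! ### Sylow bases -/

section Bases

set_option linter.unusedSectionVars false

variable {G : Type u} [Group G] [Finite G] {π ρ : ℕ → Prop}

/-- The orders of Hall subgroups for disjoint sets of primes multiply. -/
theorem IsHall.card_mul_card {H K L : Subgroup G} (hH : IsHall π H) (hK : IsHall ρ K)
    (hL : IsHall (fun p => π p ∨ ρ p) L) (hd : ∀ p, π p → ¬ ρ p) :
    Nat.card H * Nat.card K = Nat.card L := by
  have hcop : (Nat.card H).Coprime (Nat.card K) :=
    hH.card.coprime fun p hp h h' => hd p h' (hK.card p hp h)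
  refine Nat.dvd_antisymm (hcop.mul_dvd_of_dvd_of_dvd
    (hL.card_dvd fun p hp h => Or.inl (hH.card p hp h))
    (hL.card_dvd fun p hp h => Or.inr (hK.card p hp h))) ?_
  rw [Nat.dvd_iff_prime_pow_dvd_dvd]
  intro p k hp hk
  rcases Nat.eq_zero_or_pos k with rfl | hk0
  · simp
  have key : ∀ {σ : ℕ → Prop} {M : Subgroup G}, IsHall σ M → σ p → p ^ k ∣ Nat.card M := by
    intro σ M hM hσ
    have h := hk.trans L.card_subgroup_dvd_card
    rw [← M.card_mul_index] at h
    refine Nat.Coprime.dvd_of_dvd_mul_right ?_ h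
    exact Nat.Coprime.pow_left k (hp.coprime_iff_not_dvd.2 fun h => hM.index p hp h hσ)
  rcases hL.card p hp ((dvd_pow_self p hk0.ne').trans hk) with h | h
  · exact (key hH h).mul_right _
  · exact (key hK h).mul_left _

theorem exists_mul_eq_of_coprime {H K L : Subgroup G} (hH : H ≤ L) (hK : K ≤ L)
    (hcop : (Nat.card H).Coprime (Nat.card K)) (hc : Nat.card H * Nat.card K = Nat.card L) :
    ∀ g ∈ L, ∃ x ∈ H, ∃ y ∈ K, g = x * y := by
  have h1 : Nat.card (H.subgroupOf L) = Nat.card H :=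
    Nat.card_congr (Subgroup.subgroupOfEquivOfLe hH).toEquiv
  have h2 : Nat.card (K.subgroupOf L) = Nat.card K :=
    Nat.card_congr (Subgroup.subgroupOfEquivOfLe hK).toEquiv
  have h := Subgroup.isComplement'_of_coprime (H := H.subgroupOf L) (K := K.subgroupOf L)
    (by rw [h1, h2, hc]) (by rwa [h1, h2])
  intro g hg
  obtain ⟨⟨x, y⟩, e⟩ := h.2 ⟨g, hg⟩
  exact ⟨x, x.2, y, y.2, (congrArg Subtype.val e).symm⟩

theorem isHall_eq_of_sylow {p : ℕ} (hp : p.Prime) (P : Sylow p G) :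
    IsHall (· = p) (P : Subgroup G) := by
  have : Fact p.Prime := ⟨hp⟩
  refine ⟨fun q hq hd => ?_, ?_⟩
  · obtain ⟨k, hk⟩ := IsPGroup.iff_card.1 P.isPGroup'
    rw [hk] at hd
    exact (Nat.prime_dvd_prime_iff_eq hq hp).1 (hq.dvd_of_dvd_pow hd)
  · rintro q - hd rfl
    exact P.not_dvd_index hd

theorem IsHall.exists_sylow {p : ℕ} (hp : p.Prime) {H : Subgroup G} (hH : IsHall (· = p) H) :
    ∃ P : Sylow p G, (P : Subgroup G) = H := by
  have : Fact p.Prime := ⟨hp⟩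
  have h1 : IsPGroup p H :=
    IsPGroup.of_card (Nat.eq_prime_pow_of_unique_prime_dvd Nat.card_pos.ne'
      fun {d} hd h => hH.card d hd h)
  exact ⟨h1.toSylow fun h => hH.index p hp h rfl, rfl⟩

theorem coprime_of_isPi_eq {p q m n : ℕ} (hpq : p ≠ q) (hm : IsPi (· = p) m)
    (hn : IsPi (· = q) n) : m.Coprime n :=
  hm.coprime fun r hr h h' => hpq (h'.symm.trans (hn r hr h))

theorem IsHall.index_ne {p : ℕ} {K : Subgroup G} (hK : IsHall (· ≠ p) K) : IsPi (· = p) K.index :=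
  fun q hq h => not_not.1 (hK.index q hq h)

/-- An intersection of Hall `p'`-subgroups, taken over the primes `p` outside a set `π`, is a Hall
`π`-subgroup. -/
theorem isHall_iInf {K : (Nat.card G).primeFactors → Subgroup G}
    (hK : ∀ p : (Nat.card G).primeFactors, IsHall (· ≠ (p : ℕ)) (K p)) (π : ℕ → Prop) :
    IsHall π (⨅ p : {p : (Nat.card G).primeFactors // ¬ π p}, K p.1) := by
  classical
  constructor
  · intro p hp hd
    by_contra hπ
    have hpG : p ∈ (Nat.card G).primeFactors :=
      Nat.mem_primeFactors.2 ⟨hp, hd.trans (Subgroup.card_subgroup_dvd_card _), Nat.card_pos.ne'⟩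
    have hle : (⨅ p : {p : (Nat.card G).primeFactors // ¬ π p}, K p.1) ≤ K ⟨p, hpG⟩ :=
      iInf_le (fun p : {p : (Nat.card G).primeFactors // ¬ π p} => K p.1) ⟨⟨p, hpG⟩, hπ⟩
    exact (hK ⟨p, hpG⟩).card p hp (hd.trans (Subgroup.card_dvd_of_le hle)) rfl
  · have h1 : (∏ p : {p : (Nat.card G).primeFactors // ¬ π p}, (K p.1).index) ∣
        (⨅ p : {p : (Nat.card G).primeFactors // ¬ π p}, K p.1).index := by
      refine Fintype.prod_dvd_of_isRelPrime ?_ fun p => Subgroup.index_dvd_of_le (iInf_le _ _)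
      intro p q hpq
      exact Nat.coprime_iff_isRelPrime.1 (coprime_of_isPi_eq
        (fun h => hpq (Subtype.ext (Subtype.ext h))) (hK p.1).index_ne (hK q.1).index_ne)
    have h2 := Nat.le_antisymm (Nat.le_of_dvd
      (Nat.pos_of_ne_zero Subgroup.index_ne_zero_of_finite) h1) (Subgroup.index_iInf_le _)
    rw [← h2]
    intro r hr hd
    obtain ⟨q, -, hq⟩ := (Prime.dvd_finsetProd_iff hr.prime _).1 hd
    rw [(hK q.1).index_ne r hr hq]
    exact q.2

/-- The condition of a Sylow basis, as an equality of pointwise products. -/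
def Permutes (H K : Subgroup G) : Prop := {g : G | ∃ x ∈ H, ∃ y ∈ K, g = x * y} =
  {g : G | ∃ y ∈ K, ∃ x ∈ H, g = y * x}

theorem Permutes.comm {H K : Subgroup G} (h : Permutes H K) : Permutes K H := Eq.symm h

theorem Permutes.exists_swap {H K : Subgroup G} (h : Permutes H K) {x y : G} (hx : x ∈ H)
    (hy : y ∈ K) : ∃ y' ∈ K, ∃ x' ∈ H, x * y = y' * x' := by
  have : x * y ∈ {g : G | ∃ x ∈ H, ∃ y ∈ K, g = x * y} := ⟨x, hx, y, hy, rfl⟩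
  rwa [h] at this

theorem permutes_of_forall {H K : Subgroup G}
    (h : ∀ x ∈ H, ∀ y ∈ K, ∃ y' ∈ K, ∃ x' ∈ H, x * y = y' * x') : Permutes H K := by
  ext g
  constructor
  · rintro ⟨x, hx, y, hy, rfl⟩
    exact h x hx y hy
  · rintro ⟨y, hy, x, hx, rfl⟩
    obtain ⟨y', hy', x', hx', e⟩ := h _ (H.inv_mem hx) _ (K.inv_mem hy)
    exact ⟨x'⁻¹, H.inv_mem hx', y'⁻¹, K.inv_mem hy', by
      rw [← mul_inv_rev, ← e, mul_inv_rev, inv_inv, inv_inv]⟩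

theorem Permutes.exists_mul_of_mem_sup {H K : Subgroup G} (h : Permutes H K) :
    ∀ g ∈ H ⊔ K, ∃ x ∈ H, ∃ y ∈ K, g = x * y := by
  let L : Subgroup G :=
    { carrier := {g | ∃ x ∈ H, ∃ y ∈ K, g = x * y}
      one_mem' := ⟨1, H.one_mem, 1, K.one_mem, (one_mul 1).symm⟩
      mul_mem' := by
        rintro _ _ ⟨x, hx, y, hy, rfl⟩ ⟨z, hz, w, hw, rfl⟩
        obtain ⟨z', hz', y', hy', e⟩ := h.comm.exists_swap hy hz
        refine ⟨x * z', H.mul_mem hx hz', y' * w, K.mul_mem hy' hw, ?_⟩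
        rw [mul_assoc, ← mul_assoc y, e]
        group
      inv_mem' := by
        rintro _ ⟨x, hx, y, hy, rfl⟩
        rw [mul_inv_rev]
        exact h.comm.exists_swap (K.inv_mem hy) (H.inv_mem hx) }
  have hle : H ⊔ K ≤ L := sup_le (fun x hx => ⟨x, hx, 1, K.one_mem, (mul_one x).symm⟩)
    fun y hy => ⟨1, H.one_mem, y, hy, (one_mul y).symm⟩
  exact fun g hg => hle hg

theorem Permutes.sup_left {H K L : Subgroup G} (hHK : Permutes H K) (hH : Permutes H L)
    (hK : Permutes K L) : Permutes (H ⊔ K) L := by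
  refine permutes_of_forall fun g hg z hz => ?_
  obtain ⟨x, hx, y, hy, rfl⟩ := hHK.exists_mul_of_mem_sup g hg
  obtain ⟨z', hz', y', hy', e⟩ := hK.exists_swap hy hz
  obtain ⟨z'', hz'', x', hx', e'⟩ := hH.exists_swap hx hz'
  refine ⟨z'', hz'', x' * y', Subgroup.mul_mem_sup hx' hy', ?_⟩
  rw [mul_assoc, e, ← mul_assoc, e', mul_assoc]

theorem Permutes.card_sup_dvd {H K : Subgroup G} (h : Permutes H K)
    (hcop : (Nat.card H).Coprime (Nat.card K)) :
    Nat.card (H ⊔ K : Subgroup G) ∣ Nat.card H * Nat.card K := by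
  have hbij : Function.Bijective
      (fun z : H × K => (⟨z.1 * z.2, Subgroup.mul_mem_sup z.1.2 z.2.2⟩ : (H ⊔ K : Subgroup G))) := by
    constructor
    · exact fun z w hzw => Subgroup.mul_injective_of_disjoint
        (Subgroup.disjoint_of_coprime_natCard hcop) (congrArg Subtype.val hzw)
    · rintro ⟨g, hg⟩
      obtain ⟨x, hx, y, hy, rfl⟩ := h.exists_mul_of_mem_sup g hg
      exact ⟨(⟨x, hx⟩, ⟨y, hy⟩), rfl⟩
  rw [← Nat.card_prod, Nat.card_congr (Equiv.ofBijective _ hbij)]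

theorem SylowBasis.isHall (B : SylowBasis G) (p : (Nat.card G).primeFactors) :
    IsHall (· = (p : ℕ)) (B.sylow p : Subgroup G) :=
  isHall_eq_of_sylow (Nat.prime_of_mem_primeFactors p.2) _

/-- The product of the members of a Sylow basis that belong to the primes in `π` is a Hall
`π`-subgroup. -/
theorem SylowBasis.isHall_iSup (B : SylowBasis G) (π : ℕ → Prop) :
    IsHall π (⨆ p : (Nat.card G).primeFactors, ⨆ _ : π p, (B.sylow p : Subgroup G)) := by
  classical
  have key : ∀ T : Finset (Nat.card G).primeFactors,
      (∀ q, Permutes (⨆ p ∈ T, (B.sylow p : Subgroup G)) (B.sylow q)) ∧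
      IsPi (fun r => ∃ p ∈ T, r = (p : ℕ))
        (Nat.card (⨆ p ∈ T, (B.sylow p : Subgroup G) : Subgroup G)) := by
    intro T
    induction T using Finset.induction_on with
    | empty =>
      simp only [Finset.notMem_empty, iSup_false, iSup_bot, Subgroup.card_bot]
      refine ⟨fun q => permutes_of_forall fun x hx y hy => ⟨y, hy, 1, Subgroup.one_mem _, ?_⟩,
        fun p hp hd => absurd (Nat.dvd_one.1 hd) hp.ne_one⟩
      rw [Subgroup.mem_bot.1 hx, one_mul, mul_one]
    | insert p T hp ih =>
      rw [Finset.iSup_insert]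
      have hc : Permutes (B.sylow p : Subgroup G) (⨆ p ∈ T, (B.sylow p : Subgroup G)) :=
        (ih.1 p).comm
      refine ⟨fun q => hc.sup_left (B.permute p q) (ih.1 q), ?_⟩
      have hcop : (Nat.card (B.sylow p : Subgroup G)).Coprime
          (Nat.card (⨆ p ∈ T, (B.sylow p : Subgroup G) : Subgroup G)) := by
        refine (B.isHall p).card.coprime fun r hr hd hrp => ?_
        obtain ⟨q, hq, e⟩ := ih.2 r hr hd
        exact hp ((Subtype.ext (hrp.symm.trans e) : p = q) ▸ hq)
      refine IsPi.of_dvd (IsPi.mul ?_ ?_) (hc.card_sup_dvd hcop)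
      · exact fun r hr hd => ⟨p, Finset.mem_insert_self _ _, (B.isHall p).card r hr hd⟩
      · intro r hr hd
        obtain ⟨q, hq, e⟩ := ih.2 r hr hd
        exact ⟨q, Finset.mem_insert_of_mem hq, e⟩
  constructor
  · have h := (key (Finset.univ.filter fun p => π p)).2
    simp only [Finset.mem_filter, Finset.mem_univ, true_and] at h
    intro r hr hd
    obtain ⟨q, hq, rfl⟩ := h r hr hd
    exact hq
  · intro r hr hd hπ
    have hrG : r ∈ (Nat.card G).primeFactors :=
      Nat.mem_primeFactors.2 ⟨hr, hd.trans (Subgroup.index_dvd_card _), Nat.card_pos.ne'⟩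
    have hle : (B.sylow ⟨r, hrG⟩ : Subgroup G) ≤
        ⨆ p : (Nat.card G).primeFactors, ⨆ _ : π p, (B.sylow p : Subgroup G) :=
      le_iSup₂_of_le (f := fun (p : (Nat.card G).primeFactors) (_ : π p) =>
        (B.sylow p : Subgroup G)) ⟨r, hrG⟩ hπ le_rfl
    exact (B.isHall ⟨r, hrG⟩).index r hr (hd.trans (Subgroup.index_dvd_of_le hle)) rfl

variable [Group.IsSolvable G]

/-- A Sylow basis of a solvable group: `P_p` is the intersection of chosen Hall `q'`-subgroups for
the primes `q ≠ p`. -/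
theorem nonempty_sylowBasis : Nonempty (SylowBasis G) := by
  have hK : ∀ p : (Nat.card G).primeFactors, ∃ K : Subgroup G, IsHall (· ≠ (p : ℕ)) K :=
    fun p => exists_isHall _
  choose K hK using hK
  have hP : ∀ p : (Nat.card G).primeFactors, ∃ P : Sylow p G, (P : Subgroup G) =
      ⨅ q : {q : (Nat.card G).primeFactors // ¬ (q : ℕ) = p}, K q.1 :=
    fun p => (isHall_iInf hK (· = (p : ℕ))).exists_sylow (Nat.prime_of_mem_primeFactors p.2)
  choose P hP using hP
  refine ⟨⟨P, fun p q => ?_⟩⟩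
  change Permutes (P p : Subgroup G) (P q)
  by_cases hpq : p = q
  · subst hpq
    exact permutes_of_forall fun x hx y hy => ⟨x, hx, y, hy, rfl⟩
  have hne : (p : ℕ) ≠ q := fun h => hpq (Subtype.ext h)
  have hp := isHall_eq_of_sylow (Nat.prime_of_mem_primeFactors p.2) (P p)
  have hq := isHall_eq_of_sylow (Nat.prime_of_mem_primeFactors q.2) (P q)
  have hL := isHall_iInf hK (fun r => r = p ∨ r = q)
  have hcop := coprime_of_isPi_eq hne hp.card hq.card
  have hc := hp.card_mul_card hq hL (fun r h1 h2 => hne (h1.symm.trans h2))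
  have hpL : (P p : Subgroup G) ≤
      ⨅ r : {r : (Nat.card G).primeFactors // ¬ ((r : ℕ) = p ∨ (r : ℕ) = q)}, K r.1 := by
    rw [hP p]
    exact le_iInf fun r => iInf_le_of_le ⟨r, fun h => r.2 (Or.inl h)⟩ le_rfl
  have hqL : (P q : Subgroup G) ≤
      ⨅ r : {r : (Nat.card G).primeFactors // ¬ ((r : ℕ) = p ∨ (r : ℕ) = q)}, K r.1 := by
    rw [hP q]
    exact le_iInf fun r => iInf_le_of_le ⟨r, fun h => r.2 (Or.inr h)⟩ le_rfl
  exact permutes_of_forall fun x hx y hy => exists_mul_eq_of_coprime hqL hpL hcop.symm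
    (by rw [mul_comm, hc]) _ (Subgroup.mul_mem _ (hpL hx) (hqL hy))

/-- As the Hall `π`-subgroups are conjugate, there are at most as many as cosets of one of them. -/
theorem card_isHall_le {K₀ : Subgroup G} (hK₀ : IsHall π K₀) :
    Nat.card {K : Subgroup G // IsHall π K} ≤ K₀.index := by
  have h : ∀ K : {K : Subgroup G // IsHall π K},
      ∃ g : G, K₀.map (MulAut.conj g).toMonoidHom = K := fun K => K.2.exists_map_conj_eq hK₀
  choose g hg using h
  rw [Subgroup.index_eq_card]
  refine Nat.card_le_card_of_injective (fun K => (g K : G ⧸ K₀)) fun K L hKL => ?_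
  have hle : ∀ K L : {K : Subgroup G // IsHall π K}, (g K : G ⧸ K₀) = g L →
      (K : Subgroup G) ≤ L := by
    intro K L hKL
    rw [← hg K, ← hg L]
    rintro _ ⟨k, hk, rfl⟩
    have hm : (g L)⁻¹ * g K ∈ K₀ := QuotientGroup.eq.1 hKL.symm
    refine ⟨((g L)⁻¹ * g K) * k * ((g L)⁻¹ * g K)⁻¹,
      K₀.mul_mem (K₀.mul_mem hm hk) (K₀.inv_mem hm), ?_⟩
    simp [mul_assoc]
  exact Subtype.ext (le_antisymm (hle _ _ hKL) (hle _ _ hKL.symm))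

/-- A Sylow basis is determined by its Sylow complements, the products of all its members but one,
and there are at most as many Sylow `p`-complements as their index, which is the order of a Sylow
`p`-subgroup. -/
theorem card_sylowBasis_le : Nat.card (SylowBasis G) ≤ Nat.card G := by
  classical
  let f : SylowBasis G → ∀ p : (Nat.card G).primeFactors, {K : Subgroup G // IsHall (· ≠ (p : ℕ)) K} :=
    fun B p => ⟨_, B.isHall_iSup fun q => q ≠ (p : ℕ)⟩
  have hf : Function.Injective f := by
    intro B C hBC
    have hB : ∀ D : SylowBasis G, ∀ p, (D.sylow p : Subgroup G) =
        ⨅ q : {q : (Nat.card G).primeFactors // ¬ (q : ℕ) = p}, (f D q.1 : Subgroup G) := by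
      intro D p
      refine (D.isHall p).eq_of_le (isHall_iInf (fun q => (f D q).2) (· = (p : ℕ))).card
        (le_iInf fun q => ?_)
      exact le_iSup₂_of_le (f := fun (r : (Nat.card G).primeFactors) (_ : (r : ℕ) ≠ q) =>
        (D.sylow r : Subgroup G)) p (fun h => q.2 h.symm) le_rfl
    ext1
    funext p
    apply Sylow.ext
    rw [hB B, hB C, hBC]
  have hK : ∀ p : (Nat.card G).primeFactors, ∃ K : Subgroup G, IsHall (· ≠ (p : ℕ)) K :=
    fun p => exists_isHall _
  choose K hK using hK
  calc Nat.card (SylowBasis G)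
      ≤ Nat.card (∀ p : (Nat.card G).primeFactors, {K : Subgroup G // IsHall (· ≠ (p : ℕ)) K}) :=
        Nat.card_le_card_of_injective f hf
    _ = ∏ p : (Nat.card G).primeFactors, Nat.card {K : Subgroup G // IsHall (· ≠ (p : ℕ)) K} :=
        Nat.card_pi
    _ ≤ ∏ p : (Nat.card G).primeFactors, (K p).index :=
        Finset.prod_le_prod' fun p _ => card_isHall_le (hK p)
    _ ≤ Nat.card G := by
        refine Nat.le_of_dvd Nat.card_pos (Fintype.prod_dvd_of_isRelPrime ?_ fun p =>
          Subgroup.index_dvd_card _)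
        intro p q hpq
        exact Nat.coprime_iff_isRelPrime.1 (coprime_of_isPi_eq
          (fun h => hpq (Subtype.ext h)) (hK p).index_ne (hK q).index_ne)

end Bases

/-! ### Decompositions and canonical forms -/

section Decompositions

set_option linter.unusedSectionVars false

variable {G : Type*} [Group G] [Finite G] {a : ℝ}

theorem IsHall.exists_mul_eq {π ρ : ℕ → Prop} {H K : Subgroup G} (hH : IsHall π H)
    (hK : IsHall ρ K) (h : ∀ p, ρ p ↔ ¬ π p) (g : G) : ∃ x ∈ H, ∃ y ∈ K, g = x * y := by
  have hcop : (Nat.card H).Coprime (Nat.card K) :=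
    hH.card.coprime fun p hp hd => (h p).1 (hK.card p hp hd)
  have hL : IsHall (fun p => π p ∨ ρ p) (⊤ : Subgroup G) := by
    refine ⟨fun p _ _ => ?_, fun p hp hd => ?_⟩
    · rw [h]
      exact em _
    · rw [Subgroup.index_top] at hd
      exact absurd (Nat.dvd_one.1 hd) hp.ne_one
  exact exists_mul_eq_of_coprime le_top le_top hcop
    (hH.card_mul_card hK hL fun p h1 h2 => (h p).1 h2 h1) g (Subgroup.mem_top g)

theorem isAlphaDecomp_of_isHall {H K : Subgroup G} (hH : IsHall (fun p => a < (p : ℝ)) H)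
    (hK : IsHall (fun p => (p : ℝ) ≤ a) K) : IsAlphaDecomp a H K :=
  ⟨hH.exists_mul_eq hK fun _ => not_lt.symm, hH.card, hK.card⟩

theorem IsAlphaDecomp.isHall {H K : Subgroup G} (h : IsAlphaDecomp a H K) :
    IsHall (fun p => a < (p : ℝ)) H ∧ IsHall (fun p => (p : ℝ) ≤ a) K := by
  have hcop : (Nat.card H).Coprime (Nat.card K) :=
    IsPi.coprime (π := fun p => a < (p : ℝ)) h.large fun p hp hd => not_lt.2 (h.small p hp hd)
  have hle : Nat.card G ≤ Nat.card H * Nat.card K := by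
    rw [← Nat.card_prod]
    refine Nat.card_le_card_of_surjective (fun z : H × K => (z.1 * z.2 : G)) fun g => ?_
    obtain ⟨x, hx, y, hy, rfl⟩ := h.mul_eq g
    exact ⟨(⟨x, hx⟩, ⟨y, hy⟩), rfl⟩
  have hdvd := hcop.mul_dvd_of_dvd_of_dvd H.card_subgroup_dvd_card K.card_subgroup_dvd_card
  have hc := Nat.le_antisymm (Nat.le_of_dvd Nat.card_pos hdvd) hle
  have h1 : H.index = Nat.card K := by
    have := H.card_mul_index
    rw [← hc] at this
    exact Nat.eq_of_mul_eq_mul_left Nat.card_pos this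
  have h2 : K.index = Nat.card H := by
    have := K.card_mul_index
    rw [← hc, mul_comm] at this
    exact Nat.eq_of_mul_eq_mul_right Nat.card_pos this
  refine ⟨⟨h.large, ?_⟩, ⟨h.small, ?_⟩⟩
  · rw [h1]
    exact fun p hp hd => not_lt.2 (h.small p hp hd)
  · rw [h2]
    exact fun p hp hd => not_le.2 (h.large p hp hd)

/-- All `a`-decompositions of a solvable group are conjugate. Once the first members agree, the
second members are conjugate by an element `l * k` of the product of the two subgroups, and already
by `l`, which normalizes the first. -/
theorem IsAlphaDecomp.exists_conj [Group.IsSolvable G] {P₁ P₂ Q₁ Q₂ : Subgroup G}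
    (hP : IsAlphaDecomp a P₁ P₂) (hQ : IsAlphaDecomp a Q₁ Q₂) :
    ∃ g : G, P₁.map (MulAut.conj g).toMonoidHom = Q₁ ∧
      P₂.map (MulAut.conj g).toMonoidHom = Q₂ := by
  obtain ⟨g, rfl⟩ := hQ.isHall.1.exists_map_conj_eq hP.isHall.1
  have hR : IsHall (fun p => (p : ℝ) ≤ a) (P₂.map (MulAut.conj g).toMonoidHom) :=
    hP.isHall.2.of_card_eq (Subgroup.card_map_of_injective (MulAut.conj g).injective)
  obtain ⟨x, rfl⟩ := hQ.isHall.2.exists_map_conj_eq hR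
  obtain ⟨l, hl, k, hk, rfl⟩ := hQ.isHall.1.exists_mul_eq hR (fun _ => not_lt.symm) x
  have hconj : ∀ (S : Subgroup G) (s : G), s ∈ S → S.map (MulAut.conj s).toMonoidHom = S := by
    intro S s hs
    refine Subgroup.eq_of_le_of_card_ge ?_
      (Subgroup.card_map_of_injective (MulAut.conj s).injective).ge
    rintro _ ⟨u, hu, rfl⟩
    exact S.mul_mem (S.mul_mem hs hu) (S.inv_mem hs)
  have hmul : ∀ (S : Subgroup G) (s t : G), S.map (MulAut.conj (s * t)).toMonoidHom =
      (S.map (MulAut.conj t).toMonoidHom).map (MulAut.conj s).toMonoidHom := by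
    intro S s t
    rw [Subgroup.map_map, map_mul]
    rfl
  refine ⟨l * g, ?_, ?_⟩
  · rw [hmul, hconj _ l hl]
  · rw [hmul, hmul _ l k, hconj _ k hk]

theorem IsAlphaDecomp.map {H : Type*} [Group H] {P₁ P₂ : Subgroup G}
    (h : IsAlphaDecomp a P₁ P₂) (φ : G ≃* H) :
    IsAlphaDecomp a (P₁.map φ.toMonoidHom) (P₂.map φ.toMonoidHom) := by
  have hc : ∀ P : Subgroup G, Nat.card (P.map φ.toMonoidHom) = Nat.card P :=
    fun P => Subgroup.card_map_of_injective φ.injective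
  refine ⟨fun g => ?_, ?_, ?_⟩
  · obtain ⟨x, hx, y, hy, e⟩ := h.mul_eq (φ.symm g)
    refine ⟨φ x, Subgroup.mem_map_of_mem _ hx, φ y, Subgroup.mem_map_of_mem _ hy, ?_⟩
    rw [← map_mul, ← e, MulEquiv.apply_symm_apply]
  · rw [hc]
    exact h.large
  · rw [hc]
    exact h.small

theorem SylowBasis.isAlphaDecomp (B : SylowBasis G) (a : ℝ) :
    IsAlphaDecomp a (B.large a) (B.small a) :=
  isAlphaDecomp_of_isHall (B.isHall_iSup fun p => a < (p : ℝ)) (B.isHall_iSup fun p => (p : ℝ) ≤ a)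

end Decompositions

theorem TableGroup.card_eq (G : TableGroup) : Nat.card G = G.order := by
  change Nat.card (Fin G.order) = _
  simp

theorem TableGroup.order_eq_of_mulEquiv {G H : TableGroup} (φ : G ≃* H) : G.order = H.order := by
  rw [← G.card_eq, ← H.card_eq, Nat.card_congr φ.toEquiv]

/-- Decompositions of isomorphic solvable groups, with the same threshold, are isomorphic. -/
theorem IsSolvableDecomp.iso {α : ℕ → ℝ} {D E : TablePair} (hD : IsSolvableDecomp α D)
    (hE : IsSolvableDecomp α E) (φ : D.grp ≃* E.grp) : D.Iso E := by
  obtain ⟨hs, hD⟩ := hD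
  obtain ⟨hs', hE⟩ := hE
  rw [← TableGroup.order_eq_of_mulEquiv φ] at hE
  obtain ⟨g, h1, h2⟩ := (hD.map φ).exists_conj hE
  refine ⟨φ.trans (MulAut.conj g), ?_, ?_⟩
  · rw [← h1, Subgroup.map_map]
    rfl
  · rw [← h2, Subgroup.map_map]
    rfl

theorem SylowBasis.isSolvableDecomp (α : ℕ → ℝ) {G : TableGroup} (hG : Group.IsSolvable G)
    (B : SylowBasis G) :
    IsSolvableDecomp α ⟨G, B.large (α G.order), B.small (α G.order)⟩ :=
  ⟨hG, B.isAlphaDecomp _⟩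

section Canonical

variable {α : ℕ → ℝ} {Can : TablePair → TablePair} {CanGrp : TableGroup → TableGroup}

/-- The forms that come from the Sylow bases of a solvable group all coincide with the form of an
arbitrary decomposition. -/
theorem IsCanonicalDecomp.sylowForms_eq (hCan : IsCanonicalDecomp α Can) {D : TablePair}
    (hD : IsSolvableDecomp α D) : sylowForms α Can D.grp = {Can D} := by
  have hs := hD.1
  obtain ⟨B⟩ := nonempty_sylowBasis (G := D.grp)
  have h : ∀ B : SylowBasis D.grp,
      Can ⟨D.grp, B.large (α D.grp.order), B.small (α D.grp.order)⟩ = Can D := fun B =>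
    (hCan.2 _ _ (B.isSolvableDecomp α hs) hD).1
      ((B.isSolvableDecomp α hs).iso hD (MulEquiv.refl D.grp))
  ext E
  constructor
  · rintro ⟨B, rfl⟩
    exact h B
  · rintro rfl
    exact ⟨B, h B⟩

theorem IsLexLeastTable.eq_grp (hCan : IsCanonicalDecomp α Can)
    (h : IsLexLeastTable α Can CanGrp) {D : TablePair} (hD : IsSolvableDecomp α D) :
    CanGrp D.grp = (Can D).grp := by
  obtain ⟨E, hE, e⟩ := h D.grp hD.1
  have h1 := hE.1
  rw [hCan.sylowForms_eq hD] at h1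
  rw [e, Set.mem_singleton_iff.1 h1]

theorem exists_isSolvableDecomp (α : ℕ → ℝ) {G : TableGroup} (hG : Group.IsSolvable G) :
    ∃ P₁ P₂ : Subgroup G, IsSolvableDecomp α ⟨G, P₁, P₂⟩ := by
  obtain ⟨B⟩ := nonempty_sylowBasis (G := G)
  exact ⟨_, _, B.isSolvableDecomp α hG⟩

theorem IsCanonicalDecomp.exists_isLexLeastTable (hCan : IsCanonicalDecomp α Can) :
    ∃ CanGrp : TableGroup → TableGroup, IsLexLeastTable α Can CanGrp := by
  have h : ∀ G : TableGroup, ∃ M : TableGroup, Group.IsSolvable G →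
      ∃ D, IsLexLeast (sylowForms α Can G) D ∧ M = D.grp := by
    intro G
    by_cases hG : Group.IsSolvable G
    · obtain ⟨P₁, P₂, hD⟩ := exists_isSolvableDecomp α hG
      refine ⟨(Can ⟨G, P₁, P₂⟩).grp, fun _ => ⟨Can ⟨G, P₁, P₂⟩, ?_, rfl⟩⟩
      have := hCan.sylowForms_eq hD
      simp only at this
      rw [this]
      exact ⟨rfl, fun E hE => le_of_eq (by rw [Set.mem_singleton_iff.1 hE])⟩
    · exact ⟨G, fun h => absurd h hG⟩
  choose M hM using h
  exact ⟨M, hM⟩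

theorem IsLexLeastTable.isCanonicalSolvable (hCan : IsCanonicalDecomp α Can)
    (h : IsLexLeastTable α Can CanGrp) : IsCanonicalSolvable CanGrp := by
  have hiso : ∀ G : TableGroup, Group.IsSolvable G → Nonempty (G ≃* CanGrp G) := by
    intro G hG
    obtain ⟨P₁, P₂, hD⟩ := exists_isSolvableDecomp α hG
    have e : CanGrp G = (Can ⟨G, P₁, P₂⟩).grp := h.eq_grp hCan hD
    obtain ⟨φ, -⟩ := hCan.1 _ hD
    rw [e]
    exact ⟨φ⟩
  refine ⟨hiso, fun G H hG hH => ⟨?_, fun e => ?_⟩⟩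
  · rintro ⟨φ⟩
    obtain ⟨P₁, P₂, hD⟩ := exists_isSolvableDecomp α hG
    obtain ⟨Q₁, Q₂, hE⟩ := exists_isSolvableDecomp α hH
    have e1 : CanGrp G = (Can ⟨G, P₁, P₂⟩).grp := h.eq_grp hCan hD
    have e2 : CanGrp H = (Can ⟨H, Q₁, Q₂⟩).grp := h.eq_grp hCan hE
    rw [e1, e2, (hCan.2 _ _ hD hE).1 (hD.iso hE φ)]
  · obtain ⟨φ⟩ := hiso G hG
    obtain ⟨ψ⟩ := hiso H hH
    rw [← e] at ψ
    exact ⟨φ.trans ψ.symm⟩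

end Canonical

/-! ### Maximal subgroups avoiding a set -/

section Greedy

set_option linter.unusedSectionVars false

variable {G : Type*} [Group G] [Finite G] {π : ℕ → Prop}

theorem pow_succ_mem_of_mulClosed {X : Set G} (hmul : ∀ x ∈ X, ∀ y ∈ X, x * y ∈ X) {x : G}
    (hx : x ∈ X) (k : ℕ) : x ^ (k + 1) ∈ X := by
  induction k with
  | zero => simpa using hx
  | succ k ih =>
    rw [pow_succ]
    exact hmul _ ih _ hx

/-- The subgroup on a nonempty subset of a finite group that is closed under multiplication. -/
def subgroupOfMulClosed (X : Set G) (hne : X.Nonempty) (hmul : ∀ x ∈ X, ∀ y ∈ X, x * y ∈ X) :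
    Subgroup G where
  carrier := X
  mul_mem' := fun hx hy => hmul _ hx _ hy
  one_mem' := by
    obtain ⟨x, hx⟩ := hne
    have h := pow_succ_mem_of_mulClosed hmul hx (orderOf x - 1)
    rwa [Nat.sub_add_cancel (orderOf_pos x), pow_orderOf_eq_one] at h
  inv_mem' := by
    intro x hx
    obtain ⟨k, hk⟩ := Nat.exists_eq_succ_of_ne_zero (orderOf_pos x).ne'
    have h1 := pow_succ_mem_of_mulClosed hmul hx (2 * k)
    have h2 : x ^ (2 * k + 1) = x⁻¹ := by
      rw [eq_inv_iff_mul_eq_one, ← pow_succ, show 2 * k + 1 + 1 = (k + 1) * 2 by ring, pow_mul,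
        ← Nat.succ_eq_add_one, ← hk, pow_orderOf_eq_one, one_pow]
    rwa [h2] at h1

/-- By Hall's theorem, a `π`-subgroup of a solvable group that is not contained in a larger
`π`-subgroup generated by it and one element is a Hall `π`-subgroup. The `π`-subgroups are given as
the subgroups that avoid the set `bad`. -/
theorem isHall_of_maximal_avoiding [Group.IsSolvable G] {bad : Set G}
    (hbad : ∀ S : Subgroup G, IsPi π (Nat.card S) ↔ ∀ x ∈ S, x ∉ bad) {H : Subgroup G}
    (hH : ∀ x ∈ H, x ∉ bad)
    (hmax : ∀ g ∉ H, ∃ y ∈ Subgroup.closure (insert g (H : Set G)), y ∈ bad) : IsHall π H := by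
  obtain ⟨K, hK⟩ := exists_isHall (G := G) π
  obtain ⟨g, hg⟩ := hK.exists_conj_mem ((hbad H).2 hH)
  have hL : IsHall π (K.map (MulAut.conj g⁻¹).toMonoidHom) :=
    hK.of_card_eq (Subgroup.card_map_of_injective (MulAut.conj g⁻¹).injective)
  have hle : H ≤ K.map (MulAut.conj g⁻¹).toMonoidHom := fun u hu =>
    ⟨g * u * g⁻¹, hg u hu, by simp [mul_assoc]⟩
  have : H = K.map (MulAut.conj g⁻¹).toMonoidHom := by
    refine le_antisymm hle fun x hx => ?_
    by_contra hxH
    obtain ⟨y, hy, hyb⟩ := hmax x hxH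
    have hcl : Subgroup.closure (insert x (H : Set G)) ≤ K.map (MulAut.conj g⁻¹).toMonoidHom :=
      (Subgroup.closure_le _).2 (Set.insert_subset hx hle)
    exact (hbad _).1 hL.card y (hcl hy) hyb
  rw [this]
  exact hL

/-- The subgroups all of whose prime divisors exceed `a` avoid the nontrivial elements of order at
most `a`. -/
theorem isPi_lt_iff_avoids (a : ℕ) (S : Subgroup G) :
    IsPi (fun p => a < p) (Nat.card S) ↔
      ∀ x ∈ S, x ∉ {x : G | x ≠ 1 ∧ ∃ d < a, x ^ (d + 1) = 1} := by
  constructor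
  · rintro h x hx ⟨hx1, d, hd, hxd⟩
    have h1 : orderOf x ≠ 1 := fun h => hx1 (orderOf_eq_one_iff.1 h)
    have h2 := h _ (Nat.minFac_prime h1)
      ((Nat.minFac_dvd _).trans (Subgroup.orderOf_dvd_natCard S hx))
    have h3 := Nat.le_of_dvd (Nat.succ_pos d) (orderOf_dvd_of_pow_eq_one hxd)
    have h4 := Nat.minFac_le (orderOf_pos x)
    omega
  · intro h p hp hd
    by_contra hpa
    obtain ⟨x, hx⟩ := exists_prime_orderOf_dvd_card' (G := S) p (hp := ⟨hp⟩) hd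
    have := hp.pos
    refine h x x.2 ⟨fun h1 => ?_, p - 1, by omega, ?_⟩
    · have : x = 1 := Subtype.ext h1
      rw [this, orderOf_one] at hx
      exact hp.one_lt.ne hx
    · rw [Nat.sub_add_cancel hp.pos, ← hx]
      exact_mod_cast congrArg Subtype.val (pow_orderOf_eq_one x)

/-- The subgroups of order prime to `π` avoid the conjugates of the nontrivial elements of a Hall
`π`-subgroup. -/
theorem isPi_not_iff_avoids [Group.IsSolvable G] {H : Subgroup G} (hH : IsHall π H)
    (S : Subgroup G) : IsPi (fun p => ¬ π p) (Nat.card S) ↔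
      ∀ x ∈ S, x ∉ {x : G | ∃ g : G, ∃ h ∈ H, h ≠ 1 ∧ x * g = g * h} := by
  constructor
  · rintro h x hx ⟨g, y, hy, hy1, e⟩
    have e' : x = g * y * g⁻¹ := by rw [← e, mul_inv_cancel_right]
    have h1 : orderOf x ∣ Nat.card H := by
      rw [e', ← MulAut.conj_apply, MulEquiv.orderOf_eq]
      exact Subgroup.orderOf_dvd_natCard H hy
    have h2 := Nat.eq_one_of_dvd_coprimes (hH.card.coprime h) h1
      (Subgroup.orderOf_dvd_natCard S hx)
    rw [orderOf_eq_one_iff] at h2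
    rw [h2, one_mul] at e
    exact hy1 (mul_left_cancel (e.symm.trans (mul_one g).symm))
  · intro h p hp hd hπ
    obtain ⟨x, hx⟩ := exists_prime_orderOf_dvd_card' (G := S) p (hp := ⟨hp⟩) hd
    have hx' : orderOf (x : G) = p := by rw [Subgroup.orderOf_coe, hx]
    obtain ⟨g, hg⟩ := hH.exists_conj_mem (U := Subgroup.zpowers (x : G)) (by
      rw [Nat.card_zpowers, hx']
      exact fun q hq hd => (Nat.prime_dvd_prime_iff_eq hq hp).1 hd ▸ hπ)
    refine h x x.2 ⟨g⁻¹, g * x * g⁻¹, hg x (Subgroup.mem_zpowers _), fun h1 => ?_, by group⟩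
    have h2 : (x : G) = 1 := by
      rw [← conj_eq_one_iff (a := g)]
      exact h1
    rw [h2, orderOf_one] at hx'
    exact hp.one_lt.ne hx'

end Greedy

/-! ### A program logic -/

section Logic

/-- The registers `0, 1, …, L.length - 1` of the store hold the entries of `L`, and its arrays
are `A`. Nothing is said about the remaining registers. -/
structure Rep (L : List ℕ) (A : ℕ → ℕ → ℕ) (s : Store) : Prop where
  reg : ∀ i v, L[i]? = some v → s.reg i = v
  arr : s.arr = A

/-- From every store with registers `L` and arrays `A`, the program `c` halts within `T` steps in a
store with registers `L'` and arrays that satisfy `Q`. The rules for single instructions append the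
register that is written to `L` or overwrite an entry of `L`, and continue with the rest of the
program. -/
def Runs (O : List ℕ → List ℕ) (c : Prog) (L : List ℕ) (A : ℕ → ℕ → ℕ) (L' : List ℕ)
    (Q : (ℕ → ℕ → ℕ) → Prop) (T : ℕ) : Prop :=
  ∀ s, Rep L A s → ∃ s' t, Exec O c s s' t ∧ (∃ A', Rep L' A' s' ∧ Q A') ∧ t ≤ T

variable {O : List ℕ → List ℕ} {c d : Prog} {L L₁ L' : List ℕ} {A A₁ : ℕ → ℕ → ℕ}
  {Q Q₁ : (ℕ → ℕ → ℕ) → Prop} {T T₁ T₂ : ℕ} {r x y k v w N : ℕ} {s : Store}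

theorem Rep.push (h : Rep L A s) (hr : L.length = r) : Rep (L ++ [v]) A (s.setReg r v) := by
  refine ⟨fun i u hi => ?_, h.arr⟩
  rcases lt_trichotomy i L.length with hlt | rfl | hgt
  · rw [List.getElem?_append_left hlt] at hi
    simp only [Store.setReg]
    rw [Function.update_of_ne (by omega)]
    exact h.reg i u hi
  · rw [hr] at hi ⊢
    simp only [← hr, List.getElem?_concat_length, Option.some.injEq] at hi
    simp [Store.setReg, hi]
  · rw [List.getElem?_eq_none (by simp; omega)] at hi
    simp at hi

theorem Rep.set (h : Rep L A s) : Rep (L.set x v) A (s.setReg x v) := by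
  refine ⟨fun i u hi => ?_, h.arr⟩
  rw [List.getElem?_set] at hi
  by_cases hx : x = i
  · subst hx
    rw [if_pos rfl] at hi
    split_ifs at hi
    simpa [Store.setReg] using hi
  · rw [if_neg hx] at hi
    simp only [Store.setReg]
    rw [Function.update_of_ne (Ne.symm hx)]
    exact h.reg i u hi

theorem Rep.take (h : Rep L A s) (hL : L.take L'.length = L') : Rep L' A s := by
  refine ⟨fun i v hi => h.reg i v ?_, h.arr⟩
  have hlt : i < L'.length := by
    by_contra hge
    rw [List.getElem?_eq_none (not_lt.1 hge)] at hi
    simp at hi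
  rw [← hi]
  conv_rhs => rw [← hL]
  rw [List.getElem?_take_of_lt hlt]

theorem Runs.mono (h : Runs O c L A L' Q₁ T₁) (hQ : ∀ A, Q₁ A → Q A) (hT : T₁ ≤ T) :
    Runs O c L A L' Q T := fun s hs => by
  obtain ⟨s', t, he, ⟨A', hA', hq⟩, ht⟩ := h s hs
  exact ⟨s', t, he, ⟨A', hA', hQ _ hq⟩, ht.trans hT⟩

theorem Runs.of_take (h : Runs O c L A L₁ Q T) (hL : L₁.take L'.length = L') :
    Runs O c L A L' Q T := fun s hs => by
  obtain ⟨s', t, he, ⟨A', hA', hq⟩, ht⟩ := h s hs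
  exact ⟨s', t, he, ⟨A', hA'.take hL, hq⟩, ht⟩

theorem Runs.seq (h₁ : Runs O c L A L₁ Q₁ T₁) (h₂ : ∀ A₁, Q₁ A₁ → Runs O d L₁ A₁ L' Q T₂) :
    Runs O (.seq c d) L A L' Q (T₁ + T₂) := fun s hs => by
  obtain ⟨s₁, t₁, he, ⟨A₁, hA, hq⟩, ht⟩ := h₁ s hs
  obtain ⟨s₂, t₂, he', h, ht'⟩ := h₂ A₁ hq s₁ hA
  exact ⟨s₂, t₁ + t₂, .seq he he', h, Nat.add_le_add ht ht'⟩

theorem Runs.step {t : ℕ} (hc : ∀ s, Rep L A s → ∃ s', Exec O c s s' t ∧ Rep L₁ A₁ s')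
    (h : Runs O d L₁ A₁ L' Q T) : Runs O (.seq c d) L A L' Q (T + t) := by
  rw [add_comm]
  refine Runs.seq (Q₁ := (· = A₁)) (L₁ := L₁) (fun s hs => ?_) fun A hA => hA ▸ h
  obtain ⟨s', he, hr⟩ := hc s hs
  exact ⟨s', t, he, ⟨A₁, hr, rfl⟩, le_rfl⟩

theorem Runs.skip (hQ : Q A) (hL : L.take L'.length = L') : Runs O .skip L A L' Q (T + 1) :=
  fun s hs => ⟨s, 1, .skip s, ⟨A, hs.take hL, hQ⟩, by omega⟩

theorem Runs.const (hr : L.length = r) (h : Runs O d (L ++ [k]) A L' Q T) :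
    Runs O (.seq (.const r k) d) L A L' Q (T + 1) :=
  Runs.step (fun s hs => ⟨_, .const s r k, hs.push hr⟩) h

theorem Runs.add (hr : L.length = r) (hx : L[x]? = some v) (hy : L[y]? = some w)
    (h : Runs O d (L ++ [v + w]) A L' Q T) : Runs O (.seq (.add r x y) d) L A L' Q (T + 1) :=
  Runs.step (fun s hs => ⟨_, .add s r x y, by
    rw [hs.reg _ _ hx, hs.reg _ _ hy]; exact hs.push hr⟩) h

theorem Runs.sub (hr : L.length = r) (hx : L[x]? = some v) (hy : L[y]? = some w)
    (h : Runs O d (L ++ [v - w]) A L' Q T) : Runs O (.seq (.sub r x y) d) L A L' Q (T + 1) :=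
  Runs.step (fun s hs => ⟨_, .sub s r x y, by
    rw [hs.reg _ _ hx, hs.reg _ _ hy]; exact hs.push hr⟩) h

theorem Runs.load {a : ℕ} (hr : L.length = r) (hx : L[x]? = some v)
    (h : Runs O d (L ++ [A a v]) A L' Q T) : Runs O (.seq (.load r a x) d) L A L' Q (T + 1) :=
  Runs.step (fun s hs => ⟨_, .load s r a x, by
    rw [hs.reg _ _ hx, hs.arr]; exact hs.push hr⟩) h

theorem Runs.store {a : ℕ} (hx : L[x]? = some v) (hy : L[y]? = some w)
    (h : Runs O d L (Function.update A a (Function.update (A a) v w)) L' Q T) :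
    Runs O (.seq (.store a x y) d) L A L' Q (T + 1) :=
  Runs.step (fun s hs => ⟨_, .store s a x y, by
    rw [hs.reg _ _ hx, hs.reg _ _ hy]
    exact ⟨hs.reg, by simp only [Store.setArr, hs.arr]⟩⟩) h

theorem Runs.setConst (h : Runs O d (L.set x k) A L' Q T) :
    Runs O (.seq (.const x k) d) L A L' Q (T + 1) :=
  Runs.step (fun s hs => ⟨_, .const s x k, hs.set⟩) h

theorem Runs.setAdd (hx : L[x]? = some v) (hy : L[y]? = some w)
    (h : Runs O d (L.set r (v + w)) A L' Q T) : Runs O (.seq (.add r x y) d) L A L' Q (T + 1) :=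
  Runs.step (fun s hs => ⟨_, .add s r x y, by
    rw [hs.reg _ _ hx, hs.reg _ _ hy]; exact hs.set⟩) h

theorem Runs.query {a b : ℕ} {q ans : List ℕ} (hr : L.length = r) (hx : L[x]? = some v)
    (hq : (List.range v).map (A a) = q) (hans : O q = ans)
    (h : Runs O d (L ++ [ans.length]) (Function.update A b fun i => ans.getD i (A b i)) L' Q T) :
    Runs O (.seq (.query a x b r) d) L A L' Q (T + (1 + v + ans.length)) :=
  Runs.step (fun s hs => ⟨_, by
    have he := Exec.query (O := O) s a x b r ans (by
      rw [hs.reg _ _ hx, Store.word, hs.arr, hq, hans])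
    rw [hs.reg _ _ hx] at he
    exact he, Rep.push (s := s.setWord b ans) ⟨hs.reg, by simp only [Store.setWord, hs.arr]⟩ hr⟩) h

theorem Runs.ite (hx : L[x]? = some v) (h₁ : v ≠ 0 → Runs O c L A L' Q T)
    (h₀ : v = 0 → Runs O d L A L' Q T) : Runs O (.ite x c d) L A L' Q (T + 1) := fun s hs => by
  by_cases hv : v = 0
  · obtain ⟨s', t, he, h, ht⟩ := h₀ hv s hs
    exact ⟨s', 1 + t, .ite_false (by rw [hs.reg _ _ hx, hv]) he, h, by omega⟩
  · obtain ⟨s', t, he, h, ht⟩ := h₁ hv s hs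
    exact ⟨s', 1 + t, .ite_true (by rwa [hs.reg _ _ hx]) he, h, by omega⟩

/-- Run `body` with register `m` holding `0, 1, …` up to, but not including, the value of
register `n`. Register `m + 1` is used for the test only. -/
def forLt (m n : ℕ) (body : Prog) : Prog :=
  .seq (.const m 0) <| .seq (.sub (m + 1) n m) <| .loop (m + 1) <|
    .seq body <| .seq (.const (m + 1) 1) <| .seq (.add m m (m + 1)) <| .sub (m + 1) n m

theorem Runs.forLt {m n : ℕ} {body : Prog} (I : ℕ → (ℕ → ℕ → ℕ) → Prop) (hm : L.length = m)
    (hn : L[n]? = some N) (h₀ : I 0 A)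
    (hbody : ∀ k < N, ∀ A, I k A → Runs O body (L ++ [k]) A (L ++ [k]) (I (k + 1)) T) :
    Runs O (forLt m n body) L A L (I N) (N * (T + 4) + 3) := by
  have hnm : n < m := by
    rw [← hm]
    by_contra hge
    rw [List.getElem?_eq_none (not_lt.1 hge)] at hn
    simp at hn
  have hloop : ∀ j k, k + j = N → ∀ A s, Rep (L ++ [k]) A s → s.reg (m + 1) = j → I k A →
      ∃ s' t, Exec O (.loop (m + 1) <| .seq body <| .seq (.const (m + 1) 1) <|
        .seq (.add m m (m + 1)) <| .sub (m + 1) n m) s s' t ∧ (∃ A', Rep L A' s' ∧ I N A') ∧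
        t ≤ j * (T + 4) + 1 := by
    intro j
    induction j with
    | zero =>
      intro k hk A s hs hj hI
      obtain rfl : k = N := by omega
      exact ⟨s, 1, .loop_false hj, ⟨A, hs.take (by simp), hI⟩, by omega⟩
    | succ j ih =>
      intro k hk A s hs hj hI
      obtain ⟨s₁, t₁, he₁, ⟨A₁, hA₁, hI₁⟩, ht₁⟩ := hbody k (by omega) A hI s hs
      have hk₁ : s₁.reg m = k := hA₁.reg m k (by simp [← hm])
      have hn₁ : s₁.reg n = N := hA₁.reg n N (by rw [List.getElem?_append_left (by omega), hn])
      have hL₁ : Rep L A₁ s₁ := hA₁.take (by simp)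
      let s₂ := s₁.setReg (m + 1) 1
      let s₃ := s₂.setReg m (s₂.reg m + s₂.reg (m + 1))
      let s₄ := s₃.setReg (m + 1) (s₃.reg n - s₃.reg m)
      have e₂ : Exec O (.const (m + 1) 1) s₁ s₂ 1 := .const s₁ (m + 1) 1
      have e₃ : Exec O (.add m m (m + 1)) s₂ s₃ 1 := .add s₂ m m (m + 1)
      have e₄ : Exec O (.sub (m + 1) n m) s₃ s₄ 1 := .sub s₃ (m + 1) n m
      have hm₃ : s₃.reg m = k + 1 := by simp [s₃, s₂, Store.setReg, hk₁]
      have hn₃ : s₃.reg n = N := by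
        simp only [s₃, s₂, Store.setReg]
        rw [Function.update_of_ne (by omega), Function.update_of_ne (by omega), hn₁]
      have hr₄ : Rep (L ++ [k + 1]) A₁ s₄ := by
        refine ⟨fun i v hi => ?_, hA₁.arr⟩
        have hi₄ : i ≤ m → s₄.reg i = s₃.reg i := fun h => by
          simp only [s₄, Store.setReg]
          rw [Function.update_of_ne (by omega)]
        rcases lt_trichotomy i m with hlt | rfl | hgt
        · rw [List.getElem?_append_left (by omega)] at hi
          rw [hi₄ hlt.le]
          simp only [s₃, s₂, Store.setReg]
          rw [Function.update_of_ne (by omega), Function.update_of_ne (by omega)]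
          exact hL₁.reg i v hi
        · simp only [← hm, List.getElem?_concat_length, Option.some.injEq] at hi
          rw [hi₄ le_rfl, hm₃, hi]
        · rw [List.getElem?_eq_none (by simp; omega)] at hi
          simp at hi
      obtain ⟨s₅, t₅, he₅, h₅, ht₅⟩ := ih (k + 1) (by omega) A₁ s₄ hr₄
        (by simp only [s₄, Store.setReg, Function.update_self]; rw [hm₃]; rw [hn₃]; omega) hI₁
      refine ⟨s₅, _, .loop_true (by omega) (.seq he₁ (.seq e₂ (.seq e₃ e₄))) he₅, h₅, ?_⟩
      rw [Nat.succ_mul]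
      omega
  intro s hs
  have e₁ := Exec.const (O := O) s m 0
  have e₂ := Exec.sub (O := O) (s.setReg m 0) (m + 1) n m
  have hn' : s.reg n = N := hs.reg n N hn
  obtain ⟨s', t, he, h, ht⟩ := hloop N 0 (by omega) A
    ((s.setReg m 0).setReg (m + 1) ((s.setReg m 0).reg n - (s.setReg m 0).reg m))
    (by
      have h1 := (hs.push (v := 0) hm)
      refine ⟨fun i v hi => ?_, hs.arr⟩
      have hlt : i < m + 1 := by
        by_contra hge
        rw [List.getElem?_eq_none (by simp; omega)] at hi
        simp at hi
      rw [← h1.reg i v hi]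
      simp only [Store.setReg]
      rw [Function.update_of_ne (by omega)])
    (by
      simp only [Store.setReg, Function.update_self]
      rw [Function.update_of_ne (by omega), hn']
      omega) h₀
  exact ⟨s', _, .seq e₁ (.seq e₂ he), h, by omega⟩

/-- The arrays `A'` agree with `A` except possibly at the indices in `M`. -/
def Same (M : List ℕ) (A A' : ℕ → ℕ → ℕ) : Prop := ∀ a, a ∉ M → A' a = A a

theorem Same.refl (M : List ℕ) (A : ℕ → ℕ → ℕ) : Same M A A := fun _ _ => rfl

theorem Same.trans {M M₁ M₂ : List ℕ} {A A₁ A₂ : ℕ → ℕ → ℕ} (h₁ : Same M₁ A A₁)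
    (h₂ : Same M₂ A₁ A₂) (h : M₁ ⊆ M := by simp) (h' : M₂ ⊆ M := by simp) : Same M A A₂ :=
  fun a ha => (h₂ a fun hm => ha (h' hm)).trans (h₁ a fun hm => ha (h hm))

theorem Same.update (a : ℕ) (A : ℕ → ℕ → ℕ) (f : ℕ → ℕ) : Same [a] A (Function.update A a f) :=
  fun b hb => Function.update_of_ne (by simpa using hb) _ _

end Logic

/-! ### Words of table groups -/

/-- A concatenation of words of the same length `n` is indexed by division with remainder by `n`. -/
theorem getElem?_flatMap_const {β γ : Type*} (n : ℕ) (f : β → List γ) (hf : ∀ b, (f b).length = n) :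
    ∀ (l : List β) (i j : ℕ), j < n →
      (l.flatMap f)[i * n + j]? = l[i]?.bind fun b => (f b)[j]?
  | [], i, j, hj => by simp
  | b :: l, 0, j, hj => by
    rw [List.flatMap_cons, zero_mul, zero_add, List.getElem?_append_left (by rw [hf]; exact hj)]
    simp
  | b :: l, i + 1, j, hj => by
    rw [List.flatMap_cons, List.getElem?_append_right (by rw [hf]; nlinarith), hf,
      show (i + 1) * n + j - n = i * n + j by rw [Nat.succ_mul]; omega,
      getElem?_flatMap_const n f hf l i j hj]
    simp

namespace TableGroup

/-- The number of an element of a table group. -/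
def idx {G : TableGroup} (x : G) : ℕ := Fin.val (n := G.order) x

theorem idx_lt {G : TableGroup} (x : G) : idx x < G.order := Fin.isLt (n := G.order) x

theorem idx_injective {G : TableGroup} : Function.Injective (idx (G := G)) :=
  Fin.val_injective (n := G.order)

theorem exists_idx {G : TableGroup} {k : ℕ} (hk : k < G.order) : ∃ x : G, idx x = k :=
  ⟨(⟨k, hk⟩ : Fin G.order), rfl⟩

theorem length_encode (G : TableGroup) : G.encode.length = 1 + G.order * G.order := by
  simp [encode, List.length_flatMap, add_comm]

theorem getElem?_encode {G : TableGroup} (x y : G) :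
    G.encode[1 + idx x * G.order + idx y]? = some (idx (x * y)) := by
  rw [encode, add_assoc, add_comm, List.getElem?_cons_succ,
    getElem?_flatMap_const G.order _ (by simp) _ _ _ (idx_lt y)]
  have hx := idx_lt x
  have hy := idx_lt y
  simp only [List.getElem?_map]
  rw [List.getElem?_eq_getElem (by simpa using hx), List.getElem?_eq_getElem (by simpa using hy)]
  simp only [List.getElem_finRange, Option.bind_some, Option.map_some]
  rfl

end TableGroup

theorem map_range_of_finRange {n : ℕ} (f : ℕ → ℕ) (g : Fin n → ℕ) (h : ∀ x : Fin n, f x = g x) :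
    (List.range n).map f = (List.finRange n).map g := by
  rw [← List.map_coe_finRange_eq_range, List.map_map]
  exact List.map_congr_left fun x _ => h x

open TableGroup

/-! ### Arrays and vectors of a table group

The programs below keep the order `n` of the group in register `1` and the threshold in register
`2`; the registers from `3` on are used as a stack. Array `0` holds the table, arrays `1` and `2`
the two subgroups that are to be found, array `3` the set whose closure is computed, array `4` the
set that is to be avoided, array `5` the positions of the rows of the table, and entry `0` of array
`6` a single value. Sets of elements are stored as 0-1-vectors. -/

section Programs

variable {O : List ℕ → List ℕ} {d : Prog} {L L' : List ℕ} {A A' : ℕ → ℕ → ℕ}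
  {Q : (ℕ → ℕ → ℕ) → Prop} {T r x y z m : ℕ} {G : TableGroup}

/-- Array `0` contains the table of `G`, and array `5` the positions of its rows. -/
structure Tab (G : TableGroup) (A : ℕ → ℕ → ℕ) : Prop where
  mul : ∀ x y : G, A 0 (1 + idx x * G.order + idx y) = idx (x * y)
  row : ∀ i ≤ G.order, A 5 i = 1 + i * G.order

theorem Tab.of_same {M : List ℕ} (h : Tab G A) (hs : Same M A A') (h0 : 0 ∉ M := by simp)
    (h5 : 5 ∉ M := by simp) : Tab G A' :=
  ⟨by rw [hs 0 h0]; exact h.mul, by rw [hs 5 h5]; exact h.row⟩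

open Classical in
/-- The word `f` begins with the characteristic vector of the set `X`. -/
def IsInd (f : ℕ → ℕ) (X : Set G) : Prop := ∀ x : G, f (idx x) = if x ∈ X then 1 else 0

theorem IsInd.ne_zero_iff {f : ℕ → ℕ} {X : Set G} (h : IsInd f X) (x : G) :
    f (idx x) ≠ 0 ↔ x ∈ X := by
  rw [h x]
  split_ifs with hx <;> simp [hx]

theorem IsInd.eq_zero_iff {f : ℕ → ℕ} {X : Set G} (h : IsInd f X) (x : G) :
    f (idx x) = 0 ↔ x ∉ X := by
  rw [← h.ne_zero_iff x, not_not]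

theorem IsInd.insert {f : ℕ → ℕ} {X : Set G} (h : IsInd f X) (x : G) :
    IsInd (Function.update f (idx x) 1) (insert x X) := by
  intro y
  by_cases hxy : y = x
  · rw [hxy, Function.update_self, if_pos (Set.mem_insert _ _)]
  · rw [Function.update_of_ne (fun e => hxy (idx_injective e)), h y]
    by_cases hy : y ∈ X
    · rw [if_pos hy, if_pos (Set.mem_insert_of_mem x hy)]
    · rw [if_neg hy, if_neg fun h => (Set.mem_insert_iff.1 h).elim hxy hy]

theorem IsInd.congr {f g : ℕ → ℕ} {X : Set G} (h : IsInd f X) (hfg : ∀ i < G.order, g i = f i) :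
    IsInd g X := fun x => by rw [hfg _ (idx_lt x), h x]

/-! ### Arithmetic in the group -/

/-- Register `z` becomes the product of the registers `x` and `y`. -/
def mulP (z x y : ℕ) (d : Prog) : Prog :=
  .seq (.load z 5 x) <| .seq (.add (z + 1) z y) <| .seq (.load z 0 (z + 1)) d

theorem Runs.setLoad {a v : ℕ} (hx : L[x]? = some v) (h : Runs O d (L.set r (A a v)) A L' Q T) :
    Runs O (.seq (.load r a x) d) L A L' Q (T + 1) :=
  Runs.step (fun s hs => ⟨_, .load s r a x, by
    rw [hs.reg _ _ hx, hs.arr]; exact hs.set⟩) h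

theorem Runs.of_take_left {L₁ : List ℕ} (h : Runs O d L₁ A L' Q T) (hL : L.take L₁.length = L₁) :
    Runs O d L A L' Q T := fun s hs => h s (hs.take hL)

theorem Runs.mul {u v : G} (hA : Tab G A) (hr : L.length = z) (hx : L[x]? = some (idx u))
    (hy : L[y]? = some (idx v)) (h : Runs O d (L ++ [idx (u * v)]) A L' Q T) :
    Runs O (mulP z x y d) L A L' Q (T + 3) := by
  have hyz : y < L.length := by
    by_contra hge
    rw [List.getElem?_eq_none (not_lt.1 hge)] at hy
    simp at hy
  refine Runs.load hr hx (Runs.add (v := A 5 (idx u)) (w := idx v) (by simp [hr])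
    (by rw [← hr, List.getElem?_concat_length]) (by rw [List.getElem?_append_left hyz, hy])
    (Runs.setLoad (v := A 5 (idx u) + idx v) (by simp [← hr]) ?_))
  refine h.of_take_left ?_
  rw [hA.row _ (idx_lt u).le, hA.mul]
  simp [← hr, List.take_length_add_append]

/-- Register `z + 3` becomes nonzero if and only if register `x` holds a nonidentity element, that
is, one that differs from its square. -/
def neOneP (z x : ℕ) (d : Prog) : Prog :=
  mulP z x x <| .seq (.sub (z + 1) z x) <| .seq (.sub (z + 2) x z) <|
    .seq (.add (z + 3) (z + 1) (z + 2)) d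

theorem sub_add_sub_eq_zero_iff {u v : G} : idx u - idx v + (idx v - idx u) = 0 ↔ u = v :=
  ⟨fun h => idx_injective (by omega), fun h => by subst h; omega⟩

theorem Runs.neOne {u : G} (hA : Tab G A) (hr : L.length = z) (hx : L[x]? = some (idx u))
    (h : ∀ w₀ w₁ w₂ w, (w = 0 ↔ u = 1) → Runs O d (L ++ [w₀, w₁, w₂, w]) A L' Q T) :
    Runs O (neOneP z x d) L A L' Q (T + 6) := by
  have hyz : x < L.length := by
    by_contra hge
    rw [List.getElem?_eq_none (not_lt.1 hge)] at hx
    simp at hx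
  refine Runs.mul hA hr hx hx (Runs.sub (v := idx (u * u)) (w := idx u) (by simp [hr])
    (by simp [← hr]) (by rw [List.getElem?_append_left hyz, hx])
    (Runs.sub (v := idx u) (w := idx (u * u)) (by simp [hr])
      (by rw [List.append_assoc, List.getElem?_append_left hyz, hx]) (by simp [← hr])
      (Runs.add (v := idx (u * u) - idx u) (w := idx u - idx (u * u)) (by simp [hr])
        (by simp [← hr]) (by simp [← hr]) ?_)))
  simp only [List.append_assoc, List.cons_append, List.nil_append]
  refine h _ _ _ _ ?_
  rw [sub_add_sub_eq_zero_iff]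
  exact mul_eq_left

/-! ### Vectors -/

/-- Set the first `n` entries of array `dst` to zero. -/
def fillP (dst : ℕ) : Prog := forLt 3 1 (.seq (.const 4 0) <| .seq (.store dst 3 4) .skip)

theorem runs_fillP {r₀ n a : ℕ} (dst : ℕ) : Runs O (fillP dst) [r₀, n, a] A [r₀, n, a]
    (fun A' => Same [dst] A A' ∧ ∀ i < n, A' dst i = 0) (n * (3 + 4) + 3) := by
  refine Runs.forLt (fun k A' => Same [dst] A A' ∧ ∀ i < k, A' dst i = 0) rfl rfl
    ⟨Same.refl _ _, by simp⟩ ?_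
  rintro k hk A₁ ⟨hs, h⟩
  refine Runs.const rfl (Runs.store rfl rfl (Runs.skip ⟨hs.trans (Same.update _ _ _), ?_⟩ rfl))
  intro i hi
  rw [Function.update_self]
  by_cases hik : i = k
  · rw [hik, Function.update_self]
  · rw [Function.update_of_ne hik, h i (by omega)]

theorem isInd_empty {f : ℕ → ℕ} (h : ∀ i < G.order, f i = 0) : IsInd f (∅ : Set G) := fun x => by
  rw [h _ (idx_lt x)]
  simp

/-- Copy the first `n` entries of array `src` to array `dst`, with register `m` as counter. -/
def copyP (m src dst : ℕ) : Prog :=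
  forLt m 1 (.seq (.load (m + 1) src m) <| .seq (.store dst m (m + 1)) .skip)

theorem runs_copyP {n src dst : ℕ} (hm : L.length = m) (hn : L[1]? = some n) (hne : src ≠ dst) :
    Runs O (copyP m src dst) L A L (fun A' => Same [dst] A A' ∧ ∀ i < n, A' dst i = A src i)
      (n * (3 + 4) + 3) := by
  refine Runs.forLt (fun k A' => Same [dst] A A' ∧ ∀ i < k, A' dst i = A src i) hm hn
    ⟨Same.refl _ _, by simp⟩ ?_
  rintro k hk A₁ ⟨hs, h⟩
  refine Runs.load (v := k) (by simp [hm]) (by simp [← hm])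
    (Runs.store (v := k) (w := A₁ src k) (by simp [← hm]) (by simp [← hm])
    (Runs.skip ⟨hs.trans (Same.update _ _ _), ?_⟩ (by simp [List.take_length_add_append])))
  intro i hi
  rw [Function.update_self]
  by_cases hik : i = k
  · rw [hik, Function.update_self, hs src (by simpa using hne)]
  · rw [Function.update_of_ne hik, h i (by omega)]

/-! ### The subgroup generated by a set -/

/-- If the registers `5` and `6` hold elements of the set in array `3`, add their product to the
set. -/
def closeStep : Prog :=
  .seq (.load 7 3 5) <| .ite 7
    (.seq (.load 8 3 6) <| .ite 8
      (mulP 9 5 6 <| .seq (.const 10 1) <| .seq (.store 3 9 10) .skip) .skip) .skip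

/-- Multiply every two elements of the set in array `3`, `n` times over. -/
def closeP : Prog := forLt 4 1 (forLt 5 1 (forLt 6 1 closeStep))

theorem runs_closeStep {r₀ n a g k : ℕ} (x y : G) (hA : Tab G A) {X : Set G}
    (hX : IsInd (A 3) X) : Runs O closeStep [r₀, n, a, g, k, idx x, idx y] A
      [r₀, n, a, g, k, idx x, idx y] (fun A' => Same [3] A A' ∧
        IsInd (A' 3) (X ∪ {z | x ∈ X ∧ y ∈ X ∧ z = x * y})) 10 := by
  have hno : ¬ (x ∈ X ∧ y ∈ X) → X ∪ {z | x ∈ X ∧ y ∈ X ∧ z = x * y} = X := by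
    intro h
    ext z
    simp only [Set.mem_union, Set.mem_ofPred_eq]
    tauto
  refine Runs.load rfl rfl (Runs.ite rfl (fun hx => ?_) fun hx => ?_)
  · refine Runs.load rfl rfl (Runs.ite rfl (fun hy => ?_) fun hy => ?_)
    · refine Runs.mul hA rfl rfl rfl (Runs.const rfl (Runs.store rfl rfl
        (Runs.skip ⟨Same.update _ _ _, ?_⟩ rfl)))
      have : X ∪ {z | x ∈ X ∧ y ∈ X ∧ z = x * y} = insert (x * y) X := by
        ext z
        simp only [Set.mem_union, Set.mem_ofPred_eq, Set.mem_insert_iff, (hX.ne_zero_iff x).1 hx,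
          (hX.ne_zero_iff y).1 hy, true_and]
        tauto
      rw [this, Function.update_self]
      exact hX.insert _
    · exact Runs.skip ⟨Same.refl _ _, by
        rw [hno fun h => (hX.eq_zero_iff y).1 hy h.2]; exact hX⟩ rfl
  · exact Runs.skip ⟨Same.refl _ _, by
      rw [hno fun h => (hX.eq_zero_iff x).1 hx h.1]; exact hX⟩ rfl

theorem runs_closePass {r₀ a g k : ℕ} (hA : Tab G A) {X : Set G} (hX : IsInd (A 3) X) :
    Runs O (forLt 5 1 (forLt 6 1 closeStep)) [r₀, G.order, a, g, k] A [r₀, G.order, a, g, k]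
      (fun A' => Same [3] A A' ∧ ∃ Y : Set G, IsInd (A' 3) Y ∧ X ⊆ Y ∧ Y ⊆ Subgroup.closure X ∧
        ∀ u ∈ X, ∀ v ∈ X, u * v ∈ Y) (G.order * ((G.order * (10 + 4) + 3) + 4) + 3) := by
  have hrow := Runs.forLt (O := O) (A := A) (L := [r₀, G.order, a, g, k]) (m := 5) (n := 1)
    (body := forLt 6 1 closeStep) (T := G.order * (10 + 4) + 3)
    (fun i A' => Same [3] A A' ∧ ∃ Y : Set G, IsInd (A' 3) Y ∧ X ⊆ Y ∧ Y ⊆ Subgroup.closure X ∧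
      ∀ u ∈ X, ∀ v ∈ X, idx u < i → u * v ∈ Y) rfl rfl
    ⟨Same.refl _ _, X, hX, subset_rfl, Subgroup.subset_closure, by simp⟩ ?_
  · refine hrow.mono ?_ le_rfl
    rintro A' ⟨hs, Y, hY, h1, h2, h3⟩
    exact ⟨hs, Y, hY, h1, h2, fun u hu v hv => h3 u hu v hv (idx_lt u)⟩
  rintro i hi A₁ ⟨hs, Y, hY, h1, h2, h3⟩
  obtain ⟨x, rfl⟩ := exists_idx hi
  have hcol := Runs.forLt (O := O) (A := A₁) (L := [r₀, G.order, a, g, k, idx x]) (m := 6) (n := 1)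
    (body := closeStep) (T := 10)
    (fun j A' => Same [3] A A' ∧ ∃ Y : Set G, IsInd (A' 3) Y ∧ X ⊆ Y ∧ Y ⊆ Subgroup.closure X ∧
      ∀ u ∈ X, ∀ v ∈ X, idx u < idx x ∨ u = x ∧ idx v < j → u * v ∈ Y) rfl rfl
    ⟨hs, Y, hY, h1, h2, fun u hu v hv h => h3 u hu v hv (by simpa using h)⟩ ?_
  · refine hcol.mono ?_ le_rfl
    rintro A' ⟨hs, Y, hY, h1, h2, h3⟩
    refine ⟨hs, Y, hY, h1, h2, fun u hu v hv h => h3 u hu v hv ?_⟩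
    rcases Nat.lt_succ_iff_lt_or_eq.1 h with h | h
    · exact Or.inl h
    · exact Or.inr ⟨idx_injective h, idx_lt v⟩
  rintro j hj A₂ ⟨hs, Z, hZ, h1, h2, h3⟩
  obtain ⟨y, rfl⟩ := exists_idx hj
  refine (runs_closeStep x y (hA.of_same hs) hZ).mono ?_ le_rfl
  rintro A' ⟨hs', hZ'⟩
  refine ⟨hs.trans hs', _, hZ', h1.trans Set.subset_union_left, ?_, ?_⟩
  · rintro z (hz | ⟨hx, hy, rfl⟩)
    · exact h2 hz
    · exact Subgroup.mul_mem _ (h2 hx) (h2 hy)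
  · rintro u hu v hv (h | ⟨rfl, h⟩)
    · exact Or.inl (h3 u hu v hv (Or.inl h))
    · rcases Nat.lt_succ_iff_lt_or_eq.1 h with h | h
      · exact Or.inl (h3 u hu v hv (Or.inr ⟨rfl, h⟩))
      · obtain rfl := idx_injective h
        exact Or.inr ⟨h1 hu, h1 hv, rfl⟩

/-- A bound for the running time of `closeP`: each loop costs four steps per round and three steps on
top of its body, and `closeStep` costs at most ten. -/
def closeTime (n : ℕ) : ℕ := n * ((n * ((n * (10 + 4) + 3) + 4) + 3) + 4) + 3

/-- Each pass either finds the set closed under multiplication or enlarges it, so that `n` passes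
produce the generated subgroup. -/
theorem runs_closeP {r₀ a g : ℕ} (hA : Tab G A) {X : Set G} (hX : IsInd (A 3) X)
    (hne : X.Nonempty) :
    Runs O closeP [r₀, G.order, a, g] A [r₀, G.order, a, g]
      (fun A' => Same [3] A A' ∧ IsInd (A' 3) (Subgroup.closure X : Set G)) (closeTime G.order) := by
  have hfin : ∀ Y : Set G, Y.Finite := fun Y => Set.toFinite Y
  have h := Runs.forLt (O := O) (A := A) (L := [r₀, G.order, a, g]) (m := 4) (n := 1)
    (body := forLt 5 1 (forLt 6 1 closeStep))
    (T := G.order * ((G.order * (10 + 4) + 3) + 4) + 3)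
    (fun k A' => Same [3] A A' ∧ ∃ Y : Set G, IsInd (A' 3) Y ∧ X ⊆ Y ∧ Y ⊆ Subgroup.closure X ∧
      ((∀ u ∈ Y, ∀ v ∈ Y, u * v ∈ Y) ∨ k < Y.ncard)) rfl rfl
    ⟨Same.refl _ _, X, hX, subset_rfl, Subgroup.subset_closure,
      Or.inr ((Set.ncard_pos (hfin X)).2 hne)⟩ ?_
  · refine h.mono ?_ le_rfl
    rintro A' ⟨hs, Y, hY, h1, h2, h3⟩
    refine ⟨hs, ?_⟩
    have hmul : ∀ u ∈ Y, ∀ v ∈ Y, u * v ∈ Y := by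
      refine h3.resolve_right fun hlt => ?_
      have := Set.ncard_le_card Y
      rw [G.card_eq] at this
      omega
    have : Y = (Subgroup.closure X : Set G) := by
      refine subset_antisymm h2 ?_
      exact (Subgroup.closure_le (subgroupOfMulClosed Y (hne.mono h1) hmul)).2 h1
    rwa [← this]
  rintro k hk A₁ ⟨hs, Y, hY, h1, h2, h3⟩
  refine (runs_closePass (hA.of_same hs) hY).mono ?_ le_rfl
  rintro A' ⟨hs', Z, hZ, h1', h2', h3'⟩
  refine ⟨hs.trans hs', Z, hZ, h1.trans h1', ?_, ?_⟩
  · exact h2'.trans ((Subgroup.closure_le _).2 h2)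
  · by_cases hc : ∀ u ∈ Y, ∀ v ∈ Y, u * v ∈ Y
    · left
      have hcl : (Subgroup.closure Y : Set G) ⊆ Y :=
        (Subgroup.closure_le (subgroupOfMulClosed Y (hne.mono h1) hc)).2 subset_rfl
      obtain rfl : Y = Z := subset_antisymm h1' (h2'.trans hcl)
      exact hc
    · right
      have hlt : Y.ncard < Z.ncard := by
        refine Set.ncard_lt_ncard ⟨h1', fun hZY => hc fun u hu v hv => hZY (h3' u hu v hv)⟩ (hfin Z)
      have := h3.resolve_left hc
      omega

/-! ### Greedy search for a maximal subgroup -/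

/-- Entry `0` of array `6` becomes nonzero if and only if the sets in the arrays `3` and `4` have a
common element. -/
def meetP : Prog :=
  .seq (.const 4 0) <| .seq (.store 6 4 4) <| forLt 5 1 <|
    .seq (.load 6 3 5) <| .ite 6
      (.seq (.load 7 4 5) <| .ite 7 (.seq (.const 8 1) <| .seq (.store 6 4 8) .skip) .skip) .skip

theorem runs_meetP {r₀ a g : ℕ} {X bad : Set G} (hX : IsInd (A 3) X) (hbad : IsInd (A 4) bad) :
    Runs O meetP [r₀, G.order, a, g] A [r₀, G.order, a, g]
      (fun A' => Same [6] A A' ∧ (A' 6 0 ≠ 0 ↔ ∃ x ∈ X, x ∈ bad))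
      ((G.order * (7 + 4) + 3) + 1 + 1) := by
  refine Runs.const rfl (Runs.store rfl rfl ?_)
  have h := Runs.forLt (O := O) (L := [r₀, G.order, a, g, 0])
    (A := Function.update A 6 (Function.update (A 6) 0 0)) (m := 5) (n := 1)
    (body := .seq (.load 6 3 5) <| .ite 6
      (.seq (.load 7 4 5) <| .ite 7 (.seq (.const 8 1) <| .seq (.store 6 4 8) .skip) .skip) .skip)
    (T := 7) (fun k A' => Same [6] A A' ∧ (A' 6 0 ≠ 0 ↔ ∃ x ∈ X, x ∈ bad ∧ idx x < k)) rfl rfl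
    ⟨Same.update _ _ _, by simp⟩ ?_
  · refine (h.mono ?_ le_rfl).of_take rfl
    rintro A' ⟨hs, h⟩
    refine ⟨hs, h.trans ⟨?_, ?_⟩⟩
    · rintro ⟨x, h1, h2, -⟩
      exact ⟨x, h1, h2⟩
    · rintro ⟨x, h1, h2⟩
      exact ⟨x, h1, h2, idx_lt x⟩
  rintro k hk A₁ ⟨hs, h⟩
  obtain ⟨x, rfl⟩ := exists_idx hk
  have hX₁ : IsInd (A₁ 3) X := by rwa [hs 3 (by simp)]
  have hb₁ : IsInd (A₁ 4) bad := by rwa [hs 4 (by simp)]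
  have hno : ¬ (x ∈ X ∧ x ∈ bad) →
      (A₁ 6 0 ≠ 0 ↔ ∃ y ∈ X, y ∈ bad ∧ idx y < idx x + 1) := by
    intro hx
    refine h.trans ⟨?_, ?_⟩
    · rintro ⟨y, h1, h2, h3⟩
      exact ⟨y, h1, h2, by omega⟩
    · rintro ⟨y, h1, h2, h3⟩
      refine ⟨y, h1, h2, lt_of_le_of_ne (by omega) fun e => hx ?_⟩
      exact idx_injective e ▸ ⟨h1, h2⟩
  refine Runs.load rfl rfl (Runs.ite rfl (fun hx => ?_) fun hx => ?_)
  · refine Runs.load rfl rfl (Runs.ite rfl (fun hy => ?_) fun hy => ?_)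
    · refine Runs.const rfl (Runs.store rfl rfl (Runs.skip ⟨hs.trans (Same.update _ _ _), ?_⟩ rfl))
      simp only [Function.update_self]
      simp only [ne_eq, one_ne_zero, not_false_eq_true, true_iff]
      exact ⟨x, (hX₁.ne_zero_iff x).1 hx, (hb₁.ne_zero_iff x).1 hy, by omega⟩
    · exact Runs.skip ⟨hs, hno fun h => (hb₁.eq_zero_iff x).1 hy h.2⟩ rfl
  · exact Runs.skip ⟨hs, hno fun h => (hX₁.eq_zero_iff x).1 hx h.1⟩ rfl

/-- Replace the subgroup in array `b` by the subgroup generated by it and the element in register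
`3`, unless the latter meets the set in array `4`. -/
def extendP (b : ℕ) : Prog :=
  .seq (copyP 4 b 3) <| .seq (.const 4 1) <| .seq (.store 3 3 4) <| .seq closeP <| .seq meetP <|
    .seq (.const 4 0) <| .seq (.load 5 6 4) <| .ite 5 .skip (copyP 6 3 b)

/-- Starting with the empty set, extend the subgroup in array `b` by one element after the other
as long as it does not meet the set in array `4`. -/
def greedyP (b : ℕ) : Prog := .seq (fillP b) (forLt 3 1 (extendP b))

/-- A bound for the running time of `extendP`. -/
def extendTime (n : ℕ) : ℕ :=
  (n * (3 + 4) + 3) + ((closeTime n + (((n * (7 + 4) + 3) + 1 + 1) +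
    ((n * (3 + 4) + 3) + 1 + 1 + 1))) + 1 + 1)

theorem runs_extendP {r₀ a b : ℕ} (hb3 : b ≠ 3) (hb6 : b ≠ 6) (hA : Tab G A)
    {X bad : Set G} (g : G) (hX : IsInd (A b) X) (hbad : IsInd (A 4) bad) :
    Runs O (extendP b) [r₀, G.order, a, idx g] A [r₀, G.order, a, idx g]
      (fun A' => Same [b, 3, 6] A A' ∧ ∃ Y : Set G, IsInd (A' b) Y ∧
        ((∃ y ∈ Subgroup.closure (insert g X), y ∈ bad) ∧ Y = X ∨
          (¬ ∃ y ∈ Subgroup.closure (insert g X), y ∈ bad) ∧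
            Y = (Subgroup.closure (insert g X) : Set G)))
      (extendTime G.order) := by
  refine Runs.seq (runs_copyP rfl rfl hb3) ?_
  rintro A₁ ⟨hs₁, hc₁⟩
  have hX₁ : IsInd (A₁ 3) X := hX.congr hc₁
  refine Runs.const rfl (Runs.store rfl rfl ?_)
  have hs₂ := hs₁.trans (M := [3]) (Same.update 3 A₁ (Function.update (A₁ 3) (idx g) 1))
  have hX₂ : IsInd (Function.update A₁ 3 (Function.update (A₁ 3) (idx g) 1) 3) (insert g X) := by
    rw [Function.update_self]
    exact hX₁.insert g
  refine Runs.seq (L₁ := [r₀, G.order, a, idx g])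
    ((runs_closeP (hA.of_same hs₂) hX₂ (Set.insert_nonempty _ _)).of_take_left rfl) ?_
  rintro A₃ ⟨hs, hX₃⟩
  have hs₃ := hs₂.trans (M := [3]) hs
  have hbad₃ : IsInd (A₃ 4) bad := by rwa [hs₃ 4 (by simp)]
  refine Runs.seq (runs_meetP hX₃ hbad₃) ?_
  rintro A₄ ⟨hs, hm⟩
  have hs₄ := hs₃.trans (M := [3, 6]) hs
  refine Runs.const rfl (Runs.load rfl rfl (Runs.ite rfl (fun hv => ?_) fun hv => ?_))
  · refine Runs.skip ⟨hs₄.trans (Same.refl [] _), X, ?_, Or.inl ⟨hm.1 hv, rfl⟩⟩ rfl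
    rwa [hs₄ b (by simp [hb3, hb6])]
  · refine ((runs_copyP rfl rfl (Ne.symm hb3)).mono ?_ le_rfl).of_take rfl
    rintro A' ⟨hs', hc⟩
    refine ⟨hs₄.trans hs', _, IsInd.congr (f := A₃ 3) hX₃ fun i hi => ?_,
      Or.inr ⟨fun h => hm.2 h hv, rfl⟩⟩
    rw [hc i hi, hs 3 (by simp)]

theorem runs_greedyP {r₀ a b : ℕ} (hb : b = 1 ∨ b = 2) (hA : Tab G A) {bad : Set G}
    (hbad : IsInd (A 4) bad) (h1 : (1 : G) ∉ bad) :
    Runs O (greedyP b) [r₀, G.order, a] A [r₀, G.order, a]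
      (fun A' => Same [b, 3, 6] A A' ∧ ∃ H : Subgroup G, IsInd (A' b) (H : Set G) ∧
        (∀ x ∈ H, x ∉ bad) ∧
        ∀ g ∉ H, ∃ y ∈ Subgroup.closure (insert g (H : Set G)), y ∈ bad)
      ((G.order * (3 + 4) + 3) + (G.order * (extendTime G.order + 4) + 3)) := by
  have hb3 : b ≠ 3 := by omega
  have hb6 : b ≠ 6 := by omega
  have hb0 : b ≠ 0 := by omega
  have hb5 : b ≠ 5 := by omega
  refine Runs.seq (runs_fillP b) ?_
  rintro A₁ ⟨hs₁, h₁⟩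
  have h := Runs.forLt (O := O) (L := [r₀, G.order, a]) (A := A₁) (m := 3) (n := 1)
    (body := extendP b) (T := extendTime G.order)
    (fun k A' => Same [b, 3, 6] A A' ∧ ∃ X : Set G, IsInd (A' b) X ∧
      (∀ u ∈ X, ∀ v ∈ X, u * v ∈ X) ∧ (∀ x ∈ X, x ∉ bad) ∧
      ∀ g ∉ X, idx g < k → ∃ y ∈ Subgroup.closure (insert g X), y ∈ bad) rfl rfl
    ⟨hs₁.trans (Same.refl [] _), ∅, isInd_empty h₁, by simp, by simp, by simp⟩ ?_
  · refine h.mono ?_ le_rfl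
    rintro A' ⟨hs, X, hX, hmul, hav, hmax⟩
    -- The identity is never refused, so that the final set is not empty.
    have hone : (1 : G) ∈ X := by
      by_contra hX1
      obtain ⟨y, hy, hyb⟩ := hmax 1 hX1 (idx_lt _)
      have hmul' : ∀ u ∈ insert 1 X, ∀ v ∈ insert 1 X, u * v ∈ insert 1 X := by
        rintro u (rfl | hu) v (rfl | hv)
        · simp
        · rw [one_mul]; exact Or.inr hv
        · rw [mul_one]; exact Or.inr hu
        · exact Or.inr (hmul u hu v hv)
      have hcl := (Subgroup.closure_le
        (subgroupOfMulClosed (insert 1 X) (Set.insert_nonempty _ _) hmul')).2 subset_rfl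
      rcases hcl hy with rfl | hy
      · exact h1 hyb
      · exact hav y hy hyb
    exact ⟨hs, subgroupOfMulClosed X ⟨1, hone⟩ hmul, hX, hav, fun g hg => hmax g hg (idx_lt g)⟩
  rintro k hk A₂ ⟨hs, X, hX, hmul, hav, hmax⟩
  obtain ⟨g, rfl⟩ := exists_idx hk
  have hbad₂ : IsInd (A₂ 4) bad := by rwa [hs 4 (by simp; omega)]
  refine (runs_extendP hb3 hb6 (hA.of_same hs (by simp; omega) (by simp; omega)) g hX
    hbad₂).mono ?_ le_rfl
  rintro A' ⟨hs', Y, hY, ⟨hmeet, rfl⟩ | ⟨hmeet, rfl⟩⟩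
  · refine ⟨hs.trans hs', Y, hY, hmul, hav, fun g' hg' hlt => ?_⟩
    rcases Nat.lt_succ_iff_lt_or_eq.1 hlt with h | h
    · exact hmax g' hg' h
    · rw [idx_injective h]
      exact hmeet
  · refine ⟨hs.trans hs', _, hY, fun u hu v hv => Subgroup.mul_mem _ hu hv,
      fun x hx hxb => hmeet ⟨x, hx, hxb⟩, fun g' hg' hlt => ?_⟩
    have hsub : insert g X ⊆ (Subgroup.closure (insert g X) : Set G) := Subgroup.subset_closure
    rcases Nat.lt_succ_iff_lt_or_eq.1 hlt with h | h
    · have hg'X : g' ∉ X := fun h => hg' (hsub (Or.inr h))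
      obtain ⟨y, hy, hyb⟩ := hmax g' hg'X h
      refine ⟨y, Subgroup.closure_mono (Set.insert_subset_insert ?_) hy, hyb⟩
      exact (Set.subset_insert g X).trans hsub
    · exact absurd (hsub (Or.inl (idx_injective h))) hg'

/-! ### The sets to be avoided -/

/-- With `x` in register `3` and a power `x ^ (d + 1)` in entry `0` of array `6`: add `x` to the set
in array `4` if the power is the identity and `x` is not, then pass to the next power. -/
def powStep : Prog :=
  .seq (.load 6 6 4) <| neOneP 7 6 <|
    .seq (.ite 10 .skip <| neOneP 11 3 <|
      .ite 14 (.seq (.const 15 1) <| .seq (.store 4 3 15) .skip) .skip) <|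
    mulP 11 6 3 <| .seq (.store 6 4 11) .skip

/-- Add the nontrivial elements of order at most `a` to the set in array `4`. -/
def powP : Prog := forLt 3 1 (.seq (.const 4 0) <| .seq (.store 6 4 3) <| forLt 5 2 powStep)

theorem runs_powStep {r₀ n a k : ℕ} (hA : Tab G A) {X : Set G} (x u : G) (hX : IsInd (A 4) X)
    (hu : A 6 0 = idx u) :
    Runs O powStep [r₀, n, a, idx x, 0, k] A [r₀, n, a, idx x, 0, k]
      (fun A' => Same [4, 6] A A' ∧ A' 6 0 = idx (u * x) ∧
        IsInd (A' 4) (X ∪ {z | u = 1 ∧ x ≠ 1 ∧ z = x})) (11 + 5 + 6 + 1) := by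
  refine Runs.load rfl rfl (Runs.neOne hA rfl (congrArg some hu) fun w₀ w₁ w₂ w hw => ?_)
  refine Runs.seq (T₁ := 11) (T₂ := 5) (L₁ := [r₀, n, a, idx x, 0, k, A 6 0, w₀, w₁, w₂, w])
    (Q₁ := fun A' => Same [4] A A' ∧ IsInd (A' 4) (X ∪ {z | u = 1 ∧ x ≠ 1 ∧ z = x})) ?_ ?_
  · have hno : ¬ (u = 1 ∧ x ≠ 1) → X ∪ {z | u = 1 ∧ x ≠ 1 ∧ z = x} = X := by
      intro h
      ext z
      simp only [Set.mem_union, Set.mem_ofPred_eq]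
      tauto
    refine Runs.ite rfl (fun h => ?_) fun h => ?_
    · exact Runs.skip ⟨Same.refl _ _, by rw [hno fun h' => h (hw.2 h'.1)]; exact hX⟩ rfl
    refine Runs.neOne hA rfl rfl fun v₀ v₁ v₂ v hv => Runs.ite rfl (fun h' => ?_) fun h' => ?_
    · refine Runs.const rfl (Runs.store rfl rfl (Runs.skip ⟨Same.update _ _ _, ?_⟩ rfl))
      have : X ∪ {z | u = 1 ∧ x ≠ 1 ∧ z = x} = insert x X := by
        ext z
        simp only [Set.mem_union, Set.mem_ofPred_eq, Set.mem_insert_iff, hw.1 h, true_and]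
        tauto
      rw [this, Function.update_self]
      exact hX.insert x
    · exact Runs.skip ⟨Same.refl _ _, by rw [hno fun h'' => h''.2 (hv.1 h')]; exact hX⟩ rfl
  · rintro A₁ ⟨hs, hX₁⟩
    refine Runs.mul (hA.of_same hs) rfl (congrArg some hu) rfl (Runs.store rfl rfl
      (Runs.skip ⟨hs.trans (Same.update _ _ _), ?_, ?_⟩ rfl))
    · simp
    · rwa [Function.update_of_ne (by omega)]

theorem runs_powP {r₀ a : ℕ} (hA : Tab G A) (h0 : ∀ i < G.order, A 4 i = 0) :
    Runs O powP [r₀, G.order, a] A [r₀, G.order, a]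
      (fun A' => Same [4, 6] A A' ∧
        IsInd (A' 4) {x : G | x ≠ 1 ∧ ∃ d < a, x ^ (d + 1) = 1})
      (G.order * ((a * ((11 + 5 + 6 + 1) + 4) + 3) + 1 + 1 + 4) + 3) := by
  set bad : Set G := {x : G | x ≠ 1 ∧ ∃ d < a, x ^ (d + 1) = 1} with hbad
  have h := Runs.forLt (O := O) (L := [r₀, G.order, a]) (A := A) (m := 3) (n := 1)
    (body := .seq (.const 4 0) <| .seq (.store 6 4 3) <| forLt 5 2 powStep)
    (T := (a * ((11 + 5 + 6 + 1) + 4) + 3) + 1 + 1)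
    (fun k A' => Same [4, 6] A A' ∧ ∃ X : Set G, IsInd (A' 4) X ∧ X ⊆ bad ∧
      ∀ y ∈ bad, idx y < k → y ∈ X) rfl rfl
    ⟨Same.refl _ _, ∅, isInd_empty h0, by simp, by simp⟩ ?_
  · refine h.mono ?_ le_rfl
    rintro A' ⟨hs, X, hX, h1, h2⟩
    obtain rfl : X = bad := subset_antisymm h1 fun y hy => h2 y hy (idx_lt y)
    exact ⟨hs, hX⟩
  rintro k hk A₁ ⟨hs, X, hX, h1, h2⟩
  obtain ⟨x, rfl⟩ := exists_idx hk
  refine Runs.const rfl (Runs.store rfl rfl ?_)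
  have hin := Runs.forLt (O := O) (L := [r₀, G.order, a, idx x, 0])
    (A := Function.update A₁ 6 (Function.update (A₁ 6) 0 (idx x))) (m := 5) (n := 2)
    (body := powStep) (T := 11 + 5 + 6 + 1)
    (fun k A' => Same [4, 6] A A' ∧ A' 6 0 = idx (x ^ (k + 1)) ∧ ∃ X : Set G, IsInd (A' 4) X ∧
      X ⊆ bad ∧ (∀ y ∈ bad, idx y < idx x → y ∈ X) ∧ ∀ d < k, x ≠ 1 → x ^ (d + 1) = 1 → x ∈ X)
    rfl rfl ⟨hs.trans (Same.update _ _ _), by simp, X,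
      by rwa [Function.update_of_ne (by omega)], h1, h2, by simp⟩ ?_
  · refine (hin.mono ?_ le_rfl).of_take rfl
    rintro A' ⟨hs, -, X, hX, h1, h2, h3⟩
    refine ⟨hs, X, hX, h1, fun y hy hlt => ?_⟩
    rcases Nat.lt_succ_iff_lt_or_eq.1 hlt with h | h
    · exact h2 y hy h
    · obtain rfl := idx_injective h
      obtain ⟨hy1, d, hd, e⟩ := hy
      exact h3 d hd hy1 e
  rintro k hka A₂ ⟨hs, hp, X, hX, h1, h2, h3⟩
  refine (runs_powStep (hA.of_same hs) x _ hX hp).mono ?_ le_rfl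
  rintro A' ⟨hs', hp', hX'⟩
  refine ⟨hs.trans hs', by rw [hp', ← pow_succ], _, hX', ?_, fun y hy hlt => Or.inl (h2 y hy hlt),
    fun d hd hx e => ?_⟩
  · rintro z (hz | ⟨e, hx, rfl⟩)
    · exact h1 hz
    · exact ⟨hx, k, hka, e⟩
  · rcases Nat.lt_succ_iff_lt_or_eq.1 hd with h | rfl
    · exact Or.inl (h3 d h hx e)
    · exact Or.inr ⟨e, hx, rfl⟩

/-- With `g`, `h`, `x` in the registers `3`, `4`, `5`: add `x` to the set in array `4` if `h` is a
nonidentity element of the set in array `1` and `x * g = g * h`. -/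
def conjStep : Prog :=
  .seq (.load 6 1 4) <| .ite 6
    (neOneP 7 4 <| .ite 10
      (mulP 11 5 3 <| mulP 12 3 4 <| .seq (.sub 13 11 12) <| .seq (.sub 14 12 11) <|
        .seq (.add 15 13 14) <|
        .ite 15 .skip (.seq (.const 16 1) <| .seq (.store 4 5 16) .skip)) .skip) .skip

/-- Add the conjugates of the nonidentity elements of the set in array `1` to the set in
array `4`. -/
def conjP : Prog := forLt 3 1 (forLt 4 1 (forLt 5 1 conjStep))

theorem runs_conjStep {r₀ n a : ℕ} (hA : Tab G A) {H X : Set G} (g h x : G) (hH : IsInd (A 1) H)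
    (hX : IsInd (A 4) X) :
    Runs O conjStep [r₀, n, a, idx g, idx h, idx x] A [r₀, n, a, idx g, idx h, idx x]
      (fun A' => Same [4] A A' ∧
        IsInd (A' 4) (X ∪ {z | h ∈ H ∧ h ≠ 1 ∧ x * g = g * h ∧ z = x})) 22 := by
  have hno : ¬ (h ∈ H ∧ h ≠ 1 ∧ x * g = g * h) →
      X ∪ {z | h ∈ H ∧ h ≠ 1 ∧ x * g = g * h ∧ z = x} = X := by
    intro h
    ext z
    simp only [Set.mem_union, Set.mem_ofPred_eq]
    tauto
  refine Runs.load rfl rfl (Runs.ite rfl (fun hh => ?_) fun hh => ?_)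
  swap
  · exact Runs.skip ⟨Same.refl _ _, by
      rw [hno fun h' => (hH.eq_zero_iff h).1 hh h'.1]; exact hX⟩ rfl
  refine Runs.neOne hA rfl rfl fun w₀ w₁ w₂ w hw => Runs.ite rfl (fun hh1 => ?_) fun hh1 => ?_
  swap
  · exact Runs.skip ⟨Same.refl _ _, by rw [hno fun h' => h'.2.1 (hw.1 hh1)]; exact hX⟩ rfl
  refine Runs.mul (u := x) (v := g) hA rfl rfl rfl (Runs.mul (u := g) (v := h) hA rfl rfl rfl
    (Runs.sub rfl rfl rfl (Runs.sub rfl rfl rfl (Runs.add rfl rfl rfl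
      (Runs.ite rfl (fun he => ?_) fun he => ?_)))))
  · exact Runs.skip ⟨Same.refl _ _, by
      rw [hno fun h' => he (sub_add_sub_eq_zero_iff.2 h'.2.2)]; exact hX⟩ rfl
  · refine Runs.const rfl (Runs.store rfl rfl (Runs.skip ⟨Same.update _ _ _, ?_⟩ rfl))
    have : X ∪ {z | h ∈ H ∧ h ≠ 1 ∧ x * g = g * h ∧ z = x} = insert x X := by
      ext z
      simp only [Set.mem_union, Set.mem_ofPred_eq, Set.mem_insert_iff,
        (hH.ne_zero_iff h).1 hh, true_and, sub_add_sub_eq_zero_iff.1 he]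
      tauto
    rw [this, Function.update_self]
    exact hX.insert x

theorem runs_conjP {r₀ a : ℕ} (hA : Tab G A) {H : Set G} (hH : IsInd (A 1) H)
    (h0 : ∀ i < G.order, A 4 i = 0) :
    Runs O conjP [r₀, G.order, a] A [r₀, G.order, a]
      (fun A' => Same [4] A A' ∧
        IsInd (A' 4) {x : G | ∃ g : G, ∃ h ∈ H, h ≠ 1 ∧ x * g = g * h})
      (G.order * ((G.order * ((G.order * (22 + 4) + 3) + 4) + 3) + 4) + 3) := by
  set bad : Set G := {x : G | ∃ g : G, ∃ h ∈ H, h ≠ 1 ∧ x * g = g * h} with hbad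
  -- The elements to be added by the triples `(g, h, x)` that satisfy `done` have been added.
  let I : (G → G → G → Prop) → (ℕ → ℕ → ℕ) → Prop := fun done A' =>
    Same [4] A A' ∧ ∃ X : Set G, IsInd (A' 4) X ∧ X ⊆ bad ∧
      ∀ g h x, h ∈ H → h ≠ 1 → x * g = g * h → done g h x → x ∈ X
  have hI : ∀ {P R : G → G → G → Prop} {A'}, (∀ g h x, R g h x → P g h x) → I P A' → I R A' := by
    rintro P R A' hPR ⟨hs, X, hX, h1, h2⟩
    exact ⟨hs, X, hX, h1, fun g h x a b c e => h2 g h x a b c (hPR g h x e)⟩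
  have hout := Runs.forLt (O := O) (L := [r₀, G.order, a]) (A := A) (m := 3) (n := 1)
    (body := forLt 4 1 (forLt 5 1 conjStep))
    (T := G.order * ((G.order * (22 + 4) + 3) + 4) + 3)
    (fun k => I fun g _ _ => idx g < k) rfl rfl
    ⟨Same.refl _ _, ∅, isInd_empty h0, by simp, by simp⟩ ?_
  · refine hout.mono ?_ le_rfl
    rintro A' ⟨hs, X, hX, h1, h2⟩
    obtain rfl : X = bad := by
      refine subset_antisymm h1 ?_
      rintro x ⟨g, h, hh, hh1, e⟩
      exact h2 g h x hh hh1 e (idx_lt g)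
    exact ⟨hs, hX⟩
  rintro k hk A₁ hI₁
  obtain ⟨g, rfl⟩ := exists_idx hk
  have hmid := Runs.forLt (O := O) (L := [r₀, G.order, a, idx g]) (A := A₁) (m := 4) (n := 1)
    (body := forLt 5 1 conjStep) (T := G.order * (22 + 4) + 3)
    (fun k => I fun g' h _ => idx g' < idx g ∨ g' = g ∧ idx h < k) rfl rfl
    (hI (fun g' h x hd => by simpa using hd) hI₁) ?_
  · refine hmid.mono (fun A' => hI fun g' h x hd => ?_) le_rfl
    rcases Nat.lt_succ_iff_lt_or_eq.1 hd with hd | hd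
    · exact Or.inl hd
    · exact Or.inr ⟨idx_injective hd, idx_lt h⟩
  rintro k hk A₂ hI₂
  obtain ⟨h, rfl⟩ := exists_idx hk
  have hin := Runs.forLt (O := O) (L := [r₀, G.order, a, idx g, idx h]) (A := A₂) (m := 5) (n := 1)
    (body := conjStep) (T := 22)
    (fun k => I fun g' h' x => idx g' < idx g ∨ g' = g ∧ (idx h' < idx h ∨ h' = h ∧ idx x < k))
    rfl rfl (hI (fun g' h x hd => by simpa using hd) hI₂) ?_
  · refine hin.mono (fun A' => hI fun g' h' x hd => ?_) le_rfl
    rcases hd with hd | ⟨rfl, hd⟩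
    · exact Or.inl hd
    · rcases Nat.lt_succ_iff_lt_or_eq.1 hd with hd | hd
      · exact Or.inr ⟨rfl, Or.inl hd⟩
      · exact Or.inr ⟨rfl, Or.inr ⟨idx_injective hd, idx_lt x⟩⟩
  rintro k hk A₃ ⟨hs, X, hX, h1, h2⟩
  obtain ⟨x, rfl⟩ := exists_idx hk
  refine (runs_conjStep (hA.of_same hs) g h x (by rwa [hs 1 (by simp)]) hX).mono ?_ le_rfl
  rintro A' ⟨hs', hX'⟩
  refine ⟨hs.trans hs', _, hX', ?_, fun g' h' x' ha hb hc hd => ?_⟩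
  · rintro z (hz | ⟨ha, hb, hc, rfl⟩)
    · exact h1 hz
    · exact ⟨g, h, ha, hb, hc⟩
  · rcases hd with hd | ⟨rfl, hd | ⟨rfl, hd⟩⟩
    · exact Or.inl (h2 g' h' x' ha hb hc (Or.inl hd))
    · exact Or.inl (h2 g' h' x' ha hb hc (Or.inr ⟨rfl, Or.inl hd⟩))
    · rcases Nat.lt_succ_iff_lt_or_eq.1 hd with hd | hd
      · exact Or.inl (h2 g' h' x' ha hb hc (Or.inr ⟨rfl, Or.inr ⟨rfl, hd⟩⟩))
      · exact Or.inr ⟨ha, hb, idx_injective hd ▸ hc, idx_injective hd⟩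

/-! ### Input and output -/

/-- Write the positions `1 + i * n` of the rows of the table to array `5`. -/
def rowsP : Prog :=
  .seq (.const 3 0) <| .seq (.const 4 1) <| .seq (.store 5 3 4) <| forLt 5 1 <|
    .seq (.load 6 5 5) <| .seq (.add 7 6 1) <| .seq (.add 8 5 4) <| .seq (.store 5 8 7) .skip

theorem runs_rowsP {r₀ n a : ℕ} : Runs O rowsP [r₀, n, a] A [r₀, n, a]
    (fun A' => Same [5] A A' ∧ ∀ i ≤ n, A' 5 i = 1 + i * n) (n * (5 + 4) + 3 + 1 + 1 + 1) := by
  refine Runs.const rfl (Runs.const rfl (Runs.store rfl rfl ?_))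
  refine (Runs.forLt (L := [r₀, n, a, 0, 1])
    (fun k A' => Same [5] A A' ∧ ∀ i ≤ k, A' 5 i = 1 + i * n) rfl rfl
    ⟨Same.update _ _ _, by simp⟩ ?_).of_take rfl
  rintro k hk A₁ ⟨hs, h⟩
  refine Runs.load rfl rfl (Runs.add rfl rfl rfl (Runs.add rfl rfl rfl (Runs.store rfl rfl
    (Runs.skip ⟨hs.trans (Same.update _ _ _), fun i hi => ?_⟩ rfl))))
  rw [Function.update_self]
  rcases Nat.le_succ_iff.1 hi with hi | rfl
  · rw [Function.update_of_ne (by omega), h i hi]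
  · rw [Function.update_self, h k le_rfl, Nat.succ_mul, add_assoc]

/-- Copy the first `n` entries of array `src` to the entries of array `0` from the position in
register `b` on. -/
def outP (m b src : ℕ) : Prog :=
  forLt m 1 (.seq (.load (m + 1) src m) <| .seq (.add (m + 2) b m) <|
    .seq (.store 0 (m + 2) (m + 1)) .skip)

theorem runs_outP {n b p src : ℕ} (hm : L.length = m) (hn : L[1]? = some n) (hb : L[b]? = some p)
    (hsrc : src ≠ 0) : Runs O (outP m b src) L A L (fun A' => Same [0] A A' ∧
      (∀ i < n, A' 0 (p + i) = A src i) ∧ ∀ i < p, A' 0 i = A 0 i) (n * (4 + 4) + 3) := by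
  have hbm : b < L.length := by
    by_contra hge
    rw [List.getElem?_eq_none (not_lt.1 hge)] at hb
    simp at hb
  refine Runs.forLt (fun k A' => Same [0] A A' ∧ (∀ i < k, A' 0 (p + i) = A src i) ∧
    ∀ i < p, A' 0 i = A 0 i) hm hn ⟨Same.refl _ _, by simp, by simp⟩ ?_
  rintro k hk A₁ ⟨hs, h1, h2⟩
  refine Runs.load (v := k) (by simp [hm]) (by simp [← hm])
    (Runs.add (v := p) (w := k) (by simp [hm])
      (by rw [List.append_assoc, List.getElem?_append_left hbm, hb]) (by simp [← hm])
    (Runs.store (v := p + k) (w := A₁ src k) (by simp [← hm]) (by simp [← hm])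
    (Runs.skip ⟨hs.trans (Same.update _ _ _), fun i hi => ?_, fun i hi => ?_⟩
      (by simp [List.take_length_add_append]))))
  · rw [Function.update_self]
    rcases Nat.lt_succ_iff_lt_or_eq.1 hi with hi | rfl
    · rw [Function.update_of_ne (by omega), h1 i hi]
    · rw [Function.update_self, hs src (by simpa using hsrc)]
  · rw [Function.update_self, Function.update_of_ne (by omega), h2 i hi]

/-- Ask the oracle for the form of the group in array `0` with the subgroups in the arrays `1`
and `2`, and discard the subgroups from the answer. -/
def queryP : Prog :=
  .seq (.load 3 5 1) <| .seq (outP 4 3 1) <| .seq (.add 4 3 1) <| .seq (outP 5 4 2) <|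
    .seq (.add 5 4 1) <| .seq (.query 0 5 0 6) <| .seq (.const 7 0) <| .seq (.add 0 3 7) .skip

theorem IsInd.map_range {f : ℕ → ℕ} {H : Subgroup G} {p : ℕ}
    (h : IsInd (fun i => f (p + i)) (H : Set G)) :
    (List.range G.order).map (fun i => f (p + i)) = charVector G H :=
  map_range_of_finRange (fun i => f (p + i)) _ fun x => h x

/-- A bound for the running time of `queryP`. -/
def queryTime (n : ℕ) : ℕ :=
  (n * (4 + 4) + 3) + ((n * (4 + 4) + 3) +
    (1 + 1 + 1 + (1 + (1 + n * n + n + n) + (1 + n * n + n + n)) + 1) + 1) + 1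

theorem length_charVector (G : TableGroup) (P : Subgroup G) :
    (charVector G P).length = G.order :=
  (List.length_map _).trans List.length_finRange

theorem length_encode_pair (D : TablePair) :
    D.encode.length = 1 + D.grp.order * D.grp.order + D.grp.order + D.grp.order := by
  simp [TablePair.encode, length_charVector, length_encode, add_assoc]

theorem runs_queryP {r₀ a : ℕ} {H K : Subgroup G} {E : TablePair}
    (h0 : (List.range (1 + G.order * G.order)).map (A 0) = G.encode) (hA : Tab G A)
    (hH : IsInd (A 1) (H : Set G)) (hK : IsInd (A 2) (K : Set G))
    (hO : O (TablePair.encode ⟨G, H, K⟩) = E.encode) (hE : E.grp.order = G.order) :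
    Runs O queryP [r₀, G.order, a] A [1 + G.order * G.order]
      (fun A' => (List.range (1 + G.order * G.order)).map (A' 0) = E.grp.encode)
      (queryTime G.order) := by
  set n := G.order with hn
  have hlen : E.encode.length = 1 + n * n + n + n := by rw [length_encode_pair, hE]
  refine Runs.load rfl rfl ?_
  rw [hA.row _ le_rfl]
  refine Runs.seq (runs_outP (L := [r₀, n, a] ++ [1 + n * n]) (n := n) (p := 1 + n * n) rfl rfl rfl
    (by omega)) ?_
  rintro A₁ ⟨hs₁, h1, h2⟩
  refine Runs.add rfl rfl rfl (Runs.seq (runs_outP (n := n) (p := 1 + n * n + n) rfl rfl rfl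
    (by omega)) ?_)
  rintro A₂ ⟨hs₂, h3, h4⟩
  have hword : (List.range (1 + n * n + n + n)).map (A₂ 0) = TablePair.encode ⟨G, H, K⟩ := by
    rw [List.range_add, List.range_add, List.map_append, List.map_append, List.map_map,
      List.map_map, TablePair.encode]
    congr 1
    · congr 1
      · rw [← h0]
        refine List.map_congr_left fun i hi => ?_
        rw [List.mem_range] at hi
        rw [h4 i (by omega), h2 i hi]
      · exact IsInd.map_range (f := A₂ 0) (hH.congr fun i hi => by
          rw [h4 _ (by omega), h1 i hi])
    · exact IsInd.map_range (f := A₂ 0) (hK.congr fun i hi => by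
        rw [h3 i hi, hs₁ 2 (by simp)])
  have hTq : (1 + 1 + 1 + (1 + (1 + n * n + n + n) + (1 + n * n + n + n)) + 1) =
      (1 + 1 + 1 + (1 + (1 + n * n + n + n) + E.encode.length) + 1) := by rw [hlen]
  rw [hTq]
  refine Runs.add rfl rfl rfl (Runs.query rfl rfl hword hO (Runs.const rfl
    (Runs.setAdd rfl rfl (Runs.skip ?_ rfl))))
  rw [Function.update_self]
  have hl : E.grp.encode.length = 1 + n * n := by rw [length_encode, hE]
  refine List.ext_getElem (by simp [hl]) fun i h5 h6 => ?_
  rw [List.getElem_map, List.getElem_range, TablePair.encode, List.append_assoc,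
    List.getD_append _ _ _ _ h6, List.getD_eq_getElem _ _ h6]

/-- The program that finds a decomposition and queries the oracle, started with the order of the
group in register `1`, the threshold in register `2`, and the table in array `0`. -/
def coreP : Prog :=
  .seq rowsP <| .seq (fillP 4) <| .seq powP <| .seq (greedyP 1) <| .seq (fillP 4) <|
    .seq conjP <| .seq (greedyP 2) queryP

/-- A bound for the running time of `greedyP`. -/
def greedyTime (n : ℕ) : ℕ := (n * (3 + 4) + 3) + (n * (extendTime n + 4) + 3)

/-- A bound for the running time of `coreP`. -/
def coreTime (n : ℕ) : ℕ :=
  (n * (5 + 4) + 3 + 1 + 1 + 1) + ((n * (3 + 4) + 3) +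
    ((n * ((n * ((11 + 5 + 6 + 1) + 4) + 3) + 1 + 1 + 4) + 3) + (greedyTime n +
      ((n * (3 + 4) + 3) + ((n * ((n * ((n * (22 + 4) + 3) + 4) + 3) + 4) + 3) +
        (greedyTime n + queryTime n))))))

/-- For the primes that matter, the cut-off integer threshold and the real one agree. -/
theorem threshold_lt_iff {α : ℕ → ℝ} {n p : ℕ} (hp : p.Prime) (hd : p ∣ n) (hn : n ≠ 0) :
    threshold α n < p ↔ α n < p := by
  have hle := Nat.le_of_dvd (Nat.pos_of_ne_zero hn) hd
  rw [threshold, min_lt_iff, or_iff_left (not_lt.2 hle), Nat.floor_lt' hp.ne_zero]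

theorem TableGroup.order_pos (G : TableGroup) : 0 < G.order := by
  rw [← G.card_eq]
  exact Nat.card_pos

theorem runs_coreP {α : ℕ → ℝ} {Can : TablePair → TablePair} {CanGrp : TableGroup → TableGroup}
    {r₀ : ℕ} (hCan : IsCanonicalDecomp α Can) (hGrp : IsLexLeastTable α Can CanGrp)
    (hO : IsCanOracle α Can O) (hG : Group.IsSolvable G)
    (h0 : (List.range (1 + G.order * G.order)).map (A 0) = G.encode) :
    Runs O coreP [r₀, G.order, threshold α G.order] A [1 + G.order * G.order]
      (fun A' => (List.range (1 + G.order * G.order)).map (A' 0) = (CanGrp G).encode)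
      (coreTime G.order) := by
  have htab : ∀ x y : G, A 0 (1 + idx x * G.order + idx y) = idx (x * y) := by
    intro x y
    have h := getElem?_encode x y
    have hlt := (List.getElem?_eq_some_iff.1 h).1
    rw [length_encode] at hlt
    rw [← h0, List.getElem?_map, List.getElem?_range hlt, Option.map_some, Option.some.injEq] at h
    exact h
  refine Runs.seq runs_rowsP ?_
  rintro A₁ ⟨hs₁, hrow⟩
  have hA₁ : Tab G A₁ := ⟨by rw [hs₁ 0 (by simp)]; exact htab, hrow⟩
  refine Runs.seq (runs_fillP 4) ?_
  rintro A₂ ⟨hs₂, hz⟩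
  have hA₂ := hA₁.of_same hs₂
  refine Runs.seq ((runs_powP hA₂ hz).mono (fun _ h => h) ?_) ?_
  · have : threshold α G.order ≤ G.order := min_le_right _ _
    gcongr
  rintro A₃ ⟨hs₃, hbad⟩
  have hA₃ := hA₂.of_same hs₃
  refine Runs.seq (runs_greedyP (Or.inl rfl) hA₃ hbad (by simp)) ?_
  rintro A₄ ⟨hs₄, H, hH, hav, hmax⟩
  have hHall : IsHall (fun p => threshold α G.order < p) H :=
    isHall_of_maximal_avoiding (isPi_lt_iff_avoids _) hav hmax
  have hA₄ := hA₃.of_same hs₄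
  refine Runs.seq (runs_fillP 4) ?_
  rintro A₅ ⟨hs₅, hz⟩
  have hA₅ := hA₄.of_same hs₅
  refine Runs.seq (runs_conjP (H := (H : Set G)) hA₅ (by rwa [hs₅ 1 (by simp)]) hz) ?_
  rintro A₆ ⟨hs₆, hbad⟩
  have hA₆ := hA₅.of_same hs₆
  refine Runs.seq (runs_greedyP (Or.inr rfl) hA₆ hbad ?_) ?_
  · rintro ⟨g, h, -, hh1, e⟩
    rw [one_mul] at e
    exact hh1 (mul_left_cancel (e.symm.trans (mul_one g).symm))
  rintro A₇ ⟨hs₇, K, hK, hav', hmax'⟩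
  have hHall' : IsHall (fun p => ¬ threshold α G.order < p) K :=
    isHall_of_maximal_avoiding (isPi_not_iff_avoids hHall) hav' hmax'
  have hdvd : ∀ (S : Subgroup G) (p : ℕ), p ∣ Nat.card S → p ∣ G.order := fun S p hp =>
    G.card_eq ▸ hp.trans S.card_subgroup_dvd_card
  have hD : IsSolvableDecomp α ⟨G, H, K⟩ := by
    refine ⟨hG, hHall.exists_mul_eq hHall' fun _ => Iff.rfl, fun p hp hd => ?_, fun p hp hd => ?_⟩
    · exact (threshold_lt_iff hp (hdvd H p hd) G.order_pos.ne').1 (hHall.card p hp hd)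
    · exact not_lt.1 fun h => hHall'.card p hp hd
        ((threshold_lt_iff hp (hdvd K p hd) G.order_pos.ne').2 h)
  obtain ⟨φ, -⟩ := hCan.1 _ hD
  have e : CanGrp G = (Can ⟨G, H, K⟩).grp := hGrp.eq_grp hCan hD
  rw [e]
  refine runs_queryP (H := H) (K := K) ?_ (hA₆.of_same hs₇) ?_ hK (hO _ hD)
    (TableGroup.order_eq_of_mulEquiv φ).symm
  · rw [← h0, hs₇ 0 (by simp), hs₆ 0 (by simp), hs₅ 0 (by simp), hs₄ 0 (by simp), hs₃ 0 (by simp),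
      hs₂ 0 (by simp), hs₁ 0 (by simp)]
  · rwa [hs₇ 1 (by simp), hs₆ 1 (by simp), hs₅ 1 (by simp)]

end Programs

/-! ### Running times -/

/-- The function `f` is the evaluation of a polynomial. -/
def IsPolynomialFun (f : ℕ → ℕ) : Prop := ∃ q : Polynomial ℕ, ∀ n, q.eval n = f n

theorem isPolynomialFun_id : IsPolynomialFun fun n => n := ⟨Polynomial.X, fun _ => Polynomial.eval_X⟩

theorem isPolynomialFun_const (k : ℕ) : IsPolynomialFun fun _ => k := ⟨Polynomial.C k, fun _ => Polynomial.eval_C⟩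

theorem IsPolynomialFun.add {f g : ℕ → ℕ} (hf : IsPolynomialFun f) (hg : IsPolynomialFun g) : IsPolynomialFun fun n => f n + g n := by
  obtain ⟨p, hp⟩ := hf
  obtain ⟨q, hq⟩ := hg
  exact ⟨p + q, fun n => by rw [Polynomial.eval_add, hp, hq]⟩

theorem IsPolynomialFun.mul {f g : ℕ → ℕ} (hf : IsPolynomialFun f) (hg : IsPolynomialFun g) : IsPolynomialFun fun n => f n * g n := by
  obtain ⟨p, hp⟩ := hf
  obtain ⟨q, hq⟩ := hg
  exact ⟨p * q, fun n => by rw [Polynomial.eval_mul, hp, hq]⟩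

theorem isPolynomialFun_coreTime : IsPolynomialFun coreTime := by
  unfold coreTime greedyTime extendTime closeTime queryTime
  repeat' first
    | exact isPolynomialFun_const _
    | exact isPolynomialFun_id
    | apply IsPolynomialFun.add
    | apply IsPolynomialFun.mul

/-! ### The program that is given the threshold -/

theorem rep_init (w : List ℕ) (m : ℕ) : Rep (w.length :: List.replicate m 0)
    (fun a i => if a = 0 then w.getD i 0 else 0) (Store.init w) := by
  refine ⟨fun i v hi => ?_, rfl⟩
  rcases i with _ | i
  · simpa [Store.init] using hi
  · rw [List.getElem?_cons_succ, List.getElem?_replicate] at hi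
    split_ifs at hi
    simpa [Store.init] using hi

theorem computesWithin_of_rep {O : List ℕ → List ℕ} {c : Prog} {v w : List ℕ} {s : Store}
    {A : ℕ → ℕ → ℕ} {l t T : ℕ} (h : Exec O c (Store.init v) s t) (hs : Rep [l] A s)
    (hw : (List.range l).map (A 0) = w) (ht : t ≤ T) : ComputesWithin O c v w T := by
  refine ⟨s, t, h, ?_, ht⟩
  rw [Store.word, hs.arr, hs.reg 0 l rfl, hw]

theorem map_range_getD_append (w v : List ℕ) :
    (List.range w.length).map (fun i => (w ++ v).getD i 0) = w := by
  refine List.ext_getElem (by simp) fun i h1 h2 => ?_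
  rw [List.getElem_map, List.getElem_range, List.getD_append _ _ _ _ h2,
    List.getD_eq_getElem _ _ h2]

theorem getD_encode_zero (G : TableGroup) (v : List ℕ) : (G.encode ++ v).getD 0 0 = G.order := by
  simp [TableGroup.encode]

/-- Read the order of the group and the threshold from the input, of which they are the first and
the last entry. -/
def givenThresholdP : Prog :=
  .seq (.const 1 1) <| .seq (.sub 2 0 1) <| .seq (.load 2 0 2) <| .seq (.const 1 0) <|
    .seq (.load 1 0 1) coreP

theorem reducesTo_givenThresholdP {α : ℕ → ℝ} {Can : TablePair → TablePair}
    {CanGrp : TableGroup → TableGroup} (hCan : IsCanonicalDecomp α Can)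
    (hGrp : IsLexLeastTable α Can CanGrp) :
    ReducesTo α Can CanGrp (fun n => [threshold α n]) givenThresholdP (fun n => coreTime n + 5) := by
  intro O hO G hG
  have hr := rep_init (G.encode ++ [threshold α G.order]) 0
  have hlen : (G.encode ++ [threshold α G.order]).length = 1 + G.order * G.order + 1 := by
    rw [List.length_append, length_encode, List.length_singleton]
  rw [hlen] at hr
  set A : ℕ → ℕ → ℕ := fun a i =>
    if a = 0 then (G.encode ++ [threshold α G.order]).getD i 0 else 0 with hA
  have h0 : A 0 0 = G.order := getD_encode_zero G _
  have h1 : A 0 (1 + G.order * G.order) = threshold α G.order := by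
    simp only [hA, if_true]
    rw [← length_encode, List.getD_append_right _ _ _ _ le_rfl]
    simp
  have htab : (List.range (1 + G.order * G.order)).map (A 0) = G.encode := by
    rw [← length_encode]
    exact map_range_getD_append _ _
  have hrun : Runs O givenThresholdP [1 + G.order * G.order + 1] A [1 + G.order * G.order]
      (fun A' => (List.range (1 + G.order * G.order)).map (A' 0) = (CanGrp G).encode)
      (coreTime G.order + 5) := by
    refine Runs.const rfl (Runs.sub rfl rfl rfl (Runs.setLoad rfl (Runs.setConst
      (Runs.setLoad rfl ?_))))
    rw [Nat.add_sub_cancel, h0, h1]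
    exact runs_coreP hCan hGrp hO hG htab
  obtain ⟨s, t, he, ⟨A', hA', hq⟩, ht⟩ := hrun _ hr
  exact computesWithin_of_rep he hA' hq ht

/-! ### Running a program inside another one -/

/-- A number that exceeds the indices of all registers and arrays that a program uses. -/
def progBound : Prog → ℕ
  | .skip => 0
  | .const x _ => x + 1
  | .add x y z => x + y + z + 1
  | .sub x y z => x + y + z + 1
  | .load x a y => x + a + y + 1
  | .store a x y => a + x + y + 1
  | .query a x b y => a + x + b + y + 1
  | .seq c d => progBound c + progBound d
  | .ite x c d => x + 1 + progBound c + progBound d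
  | .loop x c => x + 1 + progBound c

/-- The stores agree on the registers and arrays with indices below `B`. -/
structure AgreeBelow (B : ℕ) (s u : Store) : Prop where
  reg : ∀ r < B, u.reg r = s.reg r
  arr : ∀ a < B, u.arr a = s.arr a

/-- The stores agree on the registers and arrays with indices at least `B`. -/
structure AgreeAbove (B : ℕ) (s u : Store) : Prop where
  reg : ∀ r, B ≤ r → u.reg r = s.reg r
  arr : ∀ a, B ≤ a → u.arr a = s.arr a

theorem AgreeBelow.setReg {B x v : ℕ} {s u : Store} (h : AgreeBelow B s u) :
    AgreeBelow B (s.setReg x v) (u.setReg x v) := by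
  refine ⟨fun r hr => ?_, h.arr⟩
  simp only [Store.setReg, Function.update_apply]
  split_ifs
  · rfl
  · exact h.reg r hr

theorem AgreeBelow.updateArr {B a : ℕ} {s u : Store} {f g : ℕ → ℕ} (h : AgreeBelow B s u)
    (hfg : g = f) : AgreeBelow B { s with arr := Function.update s.arr a f }
      { u with arr := Function.update u.arr a g } := by
  refine ⟨h.reg, fun b hb => ?_⟩
  simp only [Function.update_apply, hfg]
  split_ifs
  · rfl
  · exact h.arr b hb

theorem AgreeAbove.setReg {B x v : ℕ} {s u : Store} (h : AgreeAbove B s u) (hx : x < B) :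
    AgreeAbove B s (u.setReg x v) := by
  refine ⟨fun r hr => ?_, h.arr⟩
  simp only [Store.setReg]
  rw [Function.update_of_ne (by omega), h.reg r hr]

theorem AgreeAbove.updateArr {B a : ℕ} {s u : Store} {f : ℕ → ℕ} (h : AgreeAbove B s u)
    (ha : a < B) : AgreeAbove B s { u with arr := Function.update u.arr a f } := by
  refine ⟨h.reg, fun b hb => ?_⟩
  simp only
  rw [Function.update_of_ne (by omega), h.arr b hb]

theorem AgreeAbove.refl (B : ℕ) (s : Store) : AgreeAbove B s s :=
  ⟨fun _ _ => rfl, fun _ _ => rfl⟩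

theorem AgreeAbove.trans {B : ℕ} {s u v : Store} (h₁ : AgreeAbove B s u) (h₂ : AgreeAbove B u v) :
    AgreeAbove B s v :=
  ⟨fun r hr => (h₂.reg r hr).trans (h₁.reg r hr), fun a ha => (h₂.arr a ha).trans (h₁.arr a ha)⟩

/-- A run of a program depends only on the registers and arrays that the program uses, and leaves
the others alone. -/
theorem Exec.transfer {O : List ℕ → List ℕ} {B : ℕ} {c : Prog} {s s' : Store} {t : ℕ}
    (h : Exec O c s s' t) : progBound c ≤ B → ∀ u, AgreeBelow B s u →
      ∃ u', Exec O c u u' t ∧ AgreeBelow B s' u' ∧ AgreeAbove B u u' := by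
  induction h with
  | skip s => exact fun _ u hu => ⟨u, .skip u, hu, .refl _ _⟩
  | const s x k =>
    intro hB u hu
    simp only [progBound] at hB
    exact ⟨_, .const u x k, hu.setReg, (AgreeAbove.refl _ _).setReg (by omega)⟩
  | add s x y z =>
    intro hB u hu
    simp only [progBound] at hB
    refine ⟨_, .add u x y z, ?_, (AgreeAbove.refl _ _).setReg (by omega)⟩
    rw [hu.reg y (by omega), hu.reg z (by omega)]
    exact hu.setReg
  | sub s x y z =>
    intro hB u hu
    simp only [progBound] at hB
    refine ⟨_, .sub u x y z, ?_, (AgreeAbove.refl _ _).setReg (by omega)⟩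
    rw [hu.reg y (by omega), hu.reg z (by omega)]
    exact hu.setReg
  | load s x a y =>
    intro hB u hu
    simp only [progBound] at hB
    refine ⟨_, .load u x a y, ?_, (AgreeAbove.refl _ _).setReg (by omega)⟩
    rw [hu.reg y (by omega), hu.arr a (by omega)]
    exact hu.setReg
  | store s a x y =>
    intro hB u hu
    simp only [progBound] at hB
    refine ⟨_, .store u a x y, ?_, (AgreeAbove.refl _ _).updateArr (by omega)⟩
    rw [hu.reg x (by omega), hu.reg y (by omega)]
    exact hu.updateArr (by rw [hu.arr a (by omega)])
  | query s a x b y w hw =>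
    intro hB u hu
    simp only [progBound] at hB
    have hw' : w = O (u.word a (u.reg x)) := by
      rw [hw, Store.word, Store.word, hu.reg x (by omega), hu.arr a (by omega)]
    have he := Exec.query u a x b y w hw'
    rw [hu.reg x (by omega)] at he
    refine ⟨_, he, AgreeBelow.setReg (hu.updateArr ?_),
      AgreeAbove.setReg ((AgreeAbove.refl _ _).updateArr (by omega)) (by omega)⟩
    rw [hu.arr b (by omega)]
  | seq _ _ ih₁ ih₂ =>
    intro hB u hu
    simp only [progBound] at hB
    obtain ⟨u₁, e₁, h₁, g₁⟩ := ih₁ (by omega) u hu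
    obtain ⟨u₂, e₂, h₂, g₂⟩ := ih₂ (by omega) u₁ h₁
    exact ⟨u₂, .seq e₁ e₂, h₂, g₁.trans g₂⟩
  | ite_true hx _ ih =>
    intro hB u hu
    simp only [progBound] at hB
    obtain ⟨u₁, e₁, h₁, g₁⟩ := ih (by omega) u hu
    exact ⟨u₁, .ite_true (by rwa [hu.reg _ (by omega)]) e₁, h₁, g₁⟩
  | ite_false hx _ ih =>
    intro hB u hu
    simp only [progBound] at hB
    obtain ⟨u₁, e₁, h₁, g₁⟩ := ih (by omega) u hu
    exact ⟨u₁, .ite_false (by rwa [hu.reg _ (by omega)]) e₁, h₁, g₁⟩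
  | loop_true hx _ _ ih₁ ih₂ =>
    intro hB u hu
    have hB' := hB
    simp only [progBound] at hB'
    obtain ⟨u₁, e₁, h₁, g₁⟩ := ih₁ (by omega) u hu
    obtain ⟨u₂, e₂, h₂, g₂⟩ := ih₂ hB u₁ h₁
    exact ⟨u₂, .loop_true (by rwa [hu.reg _ (by omega)]) e₁ e₂, h₂, g₁.trans g₂⟩
  | loop_false hx =>
    intro hB u hu
    simp only [progBound] at hB
    exact ⟨u, .loop_false (by rwa [hu.reg _ (by omega)]), hu, .refl _ _⟩

/-! ### The program that computes the threshold -/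

/-- Save the input in array `B`, its first entry in register `B` and its length in register
`B + 1`, and replace the input by the word that consists of its first entry. -/
def saveP (B : ℕ) : Prog :=
  .seq (.load B 0 1) <| .seq (.add (B + 1) 0 1) <|
    .seq (forLt (B + 2) 0 (.seq (.load (B + 3) 0 (B + 2)) <| .seq (.store B (B + 2) (B + 3)) <|
      .seq (.store 0 (B + 2) 1) .skip)) <|
    .seq (.store 0 1 B) <| .seq (.const 0 1) .skip

/-- Restore the input, and put the first entry of it, and of the present array `0`, into the
registers `1` and `2`. -/
def restoreP (B : ℕ) : Prog :=
  .seq (.const (B + 2) 0) <| .seq (.load (B + 3) 0 (B + 2)) <|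
    .seq (forLt (B + 4) (B + 1) (.seq (.load (B + 5) B (B + 4)) <|
      .seq (.store 0 (B + 4) (B + 5)) .skip)) <|
    .seq (.add 1 B (B + 2)) <| .seq (.add 2 (B + 3) (B + 2)) .skip

theorem runs_saveP {O : List ℕ → List ℕ} {A : ℕ → ℕ → ℕ} {B l : ℕ} (hB : 2 ≤ B)
    (hl : ∀ i, l ≤ i → A 0 i = 0) :
    Runs O (saveP B) (l :: List.replicate (B - 1) 0) A
      (1 :: List.replicate (B - 1) 0 ++ [A 0 0, l])
      (fun A' => Same [0, B] A A' ∧ (∀ i < l, A' B i = A 0 i) ∧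
        A' 0 = fun i => [A 0 0].getD i 0) ((l * (4 + 4) + 3) + (1 + 1 + 1) + 1 + 1) := by
  obtain ⟨b, rfl⟩ : ∃ b, B = b + 2 := ⟨B - 2, by omega⟩
  simp only [show b + 2 - 1 = b + 1 by omega, List.replicate_succ]
  refine Runs.load (v := 0) (by simp) rfl ?_
  refine Runs.add (v := l) (w := 0) (by simp) rfl rfl ?_
  have hlist : l :: 0 :: List.replicate b 0 ++ [A 0 0] ++ [l + 0] =
      l :: 0 :: (List.replicate b 0 ++ [A 0 0, l]) := by simp
  rw [hlist]
  have hb : ∀ x y : ℕ, (x :: y :: (List.replicate b 0 ++ [A 0 0, l]))[b + 2]? = some (A 0 0) := by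
    intro x y
    simp
  refine Runs.seq (T₁ := l * (4 + 4) + 3) (T₂ := 1 + 1 + 1) (Runs.forLt (L := l :: 0 :: (List.replicate b 0 ++ [A 0 0, l])) (m := b + 2 + 2)
    (n := 0) (fun k A' => Same [0, b + 2] A A' ∧ (∀ i < k, A' (b + 2) i = A 0 i) ∧
    ∀ i, A' 0 i = if i < k then 0 else A 0 i) (T := 4) (N := l) (by simp) rfl
    ⟨Same.refl _ _, by simp, by simp⟩ ?_) ?_
  · rintro k hk A₁ ⟨hs, h1, h2⟩
    refine Runs.load (v := k) (by simp) (by simp) ?_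
    refine Runs.store (v := k) (w := A₁ 0 k) (by simp)
      (by simp) ?_
    refine Runs.store (v := k) (w := 0) (by simp) rfl ?_
    refine Runs.skip ⟨(hs.trans (M := [0, b + 2]) (Same.update _ _ _)).trans (Same.update _ _ _),
      fun i hi => ?_, fun i => ?_⟩ ?_
    · rw [Function.update_of_ne (show b + 2 ≠ 0 by omega), Function.update_self]
      rcases Nat.lt_succ_iff_lt_or_eq.1 hi with hi | rfl
      · rw [Function.update_of_ne (by omega), h1 i hi]
      · rw [Function.update_self, h2, if_neg (lt_irrefl i)]
    · rw [Function.update_self, Function.update_of_ne (show 0 ≠ b + 2 by omega)]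
      by_cases hik : i = k
      · rw [hik, Function.update_self, if_pos (by omega)]
      · rw [Function.update_of_ne hik, h2]
        exact if_congr (by omega) rfl rfl
    · simp [List.take_append, List.take_of_length_le]
  · rintro A₁ ⟨hs, h1, h2⟩
    refine Runs.store (v := 0) (w := A 0 0) rfl (hb _ _) (Runs.setConst (Runs.skip
      ⟨hs.trans (Same.update _ _ _), fun i hi => ?_, ?_⟩ ?_))
    · rw [Function.update_of_ne (by omega), h1 i hi]
    · rw [Function.update_self]
      funext i
      rcases i with _ | i
      · simp
      · rw [Function.update_of_ne (by omega), h2]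
        have : [A 0 0].getD (i + 1) 0 = 0 := by simp
        rw [this]
        split_ifs with h
        · rfl
        · exact hl _ (by omega)
    · simp

theorem runs_restoreP {O : List ℕ → List ℕ} {A : ℕ → ℕ → ℕ} {B l n : ℕ} {L : List ℕ} (hB : 3 ≤ B)
    (hL : L.length = B + 2) (hn : L[B]? = some n) (hl : L[B + 1]? = some l) :
    Runs O (restoreP B) L A [L.getD 0 0, n, A 0 0] (fun A' => ∀ i < l, A' 0 i = A B i)
      ((l * (3 + 4) + 3) + (1 + 1 + 1) + 1 + 1) := by
  have happ : ∀ {i v : ℕ} (M : List ℕ), L[i]? = some v → (L ++ M)[i]? = some v := by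
    intro i v M h
    rw [List.getElem?_append_left (List.getElem?_eq_some_iff.1 h).1, h]
  refine Runs.const (by simp [hL]) (Runs.load (v := 0) (by simp [hL]) (by simp [← hL]) ?_)
  rw [List.append_assoc]
  refine Runs.seq (T₁ := l * (3 + 4) + 3) (T₂ := 1 + 1 + 1) (Runs.forLt (L := L ++ ([0] ++ [A 0 0])) (m := B + 4) (n := B + 1)
    (fun k A' => Same [0] A A' ∧ ∀ i < k, A' 0 i = A B i) (T := 3)
    (N := l) (by simp [hL]) (happ _ hl) ⟨Same.refl _ _, by simp⟩ ?_) ?_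
  · rintro k hk A₁ ⟨hs, h1⟩
    refine Runs.load (v := k) (by simp [hL]) (by simp [hL]) ?_
    refine Runs.store (v := k) (w := A₁ B k) (by simp [hL])
      (by simp [hL]) ?_
    refine Runs.skip ⟨hs.trans (Same.update _ _ _), fun i hi => ?_⟩ ?_
    · rw [Function.update_self]
      rcases Nat.lt_succ_iff_lt_or_eq.1 hi with hi | rfl
      · rw [Function.update_of_ne (by omega), h1 i hi]
      · rw [Function.update_self, hs B (by simp; omega)]
    · simp [List.take_append, List.take_of_length_le]
  · rintro A₁ ⟨hs, h1⟩
    refine Runs.setAdd (happ _ hn) (w := 0) (by simp [hL]) ?_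
    refine Runs.setAdd (v := A 0 0) (w := 0)
      (by rw [List.getElem?_set_ne (by omega)]; simp [hL])
      (by rw [List.getElem?_set_ne (by omega)]; simp [hL]) ?_
    refine Runs.skip h1 ?_
    match L, hL with
    | r₀ :: r₁ :: r₂ :: L, _ => simp
    | [], h | [_], h | [_, _], h => simp at h <;> omega

/-- Compute the threshold with the program `c`, after the input has been saved beyond the registers
and arrays that `c` uses, and go on as if the threshold had been given. -/
def computedThresholdP (c : Prog) : Prog :=
  .seq (saveP (progBound c + 3)) <| .seq c <| .seq (restoreP (progBound c + 3)) coreP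

theorem reducesTo_computedThresholdP {α : ℕ → ℝ} {c : Prog} {T : ℕ → ℕ}
    (hc : ∀ (O : List ℕ → List ℕ) (n : ℕ), 1 ≤ n → ComputesWithin O c [n] [threshold α n] (T n))
    {Can : TablePair → TablePair} {CanGrp : TableGroup → TableGroup}
    (hCan : IsCanonicalDecomp α Can) (hGrp : IsLexLeastTable α Can CanGrp) :
    ReducesTo α Can CanGrp (fun _ => []) (computedThresholdP c) (fun n =>
      (((1 + n * n) * (4 + 4) + 3) + (1 + 1 + 1) + 1 + 1) + (T n +
        ((((1 + n * n) * (3 + 4) + 3) + (1 + 1 + 1) + 1 + 1) + coreTime n))) := by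
  intro O hO G hG
  set n := G.order with hn
  set B := progBound c + 3 with hB
  rw [List.append_nil]
  have hr := rep_init G.encode (B - 1)
  rw [length_encode, ← hn] at hr
  set A : ℕ → ℕ → ℕ := fun a i => if a = 0 then G.encode.getD i 0 else 0 with hA
  have h0 : A 0 0 = n := by
    have := getD_encode_zero G []
    rwa [List.append_nil] at this
  have htab : (List.range (1 + n * n)).map (A 0) = G.encode := by
    have := map_range_getD_append G.encode []
    rwa [List.append_nil, length_encode] at this
  obtain ⟨s₁, t₁, e₁, ⟨A₁, hr₁, hs₁, hsave, hzero⟩, ht₁⟩ := runs_saveP (O := O) (by omega)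
    (fun i hi => by
      simp only [hA, if_true]
      rw [List.getD_eq_default _ _ (by rw [length_encode]; exact hi)]) _ hr
  rw [h0] at hr₁ hzero
  obtain ⟨s₂, t₂, e₂, hw, ht₂⟩ := hc O n G.order_pos
  have hbelow : AgreeBelow B (Store.init [n]) s₁ := by
    refine ⟨fun r hr => ?_, fun a ha => ?_⟩
    · refine hr₁.reg r _ ?_
      rcases r with _ | r
      · rfl
      · rw [List.cons_append, List.getElem?_cons_succ, List.getElem?_append_left (by simp; omega),
          List.getElem?_replicate, if_pos (by omega)]
        simp [Store.init]
    · rw [hr₁.arr]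
      by_cases ha0 : a = 0
      · subst ha0
        rw [hzero]
        rfl
      · rw [hs₁ a (by simp; omega)]
        funext i
        simp [hA, Store.init, ha0]
  obtain ⟨u₂, e₂', hb₂, ha₂⟩ := e₂.transfer (B := B) (by omega) s₁ hbelow
  have hthr : u₂.arr 0 0 = threshold α n := by
    rw [hb₂.arr 0 (by omega)]
    have hlen := congrArg List.length hw
    simp only [Store.word, List.length_map, List.length_range, List.length_singleton] at hlen
    rw [Store.word, hlen] at hw
    simpa using hw
  have hreg : ∀ {i v : ℕ}, B ≤ i → s₁.reg i = v → i < B + 2 →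
      ((List.range (B + 2)).map u₂.reg)[i]? = some v := by
    intro i v hi hv hlt
    rw [List.getElem?_map, List.getElem?_range hlt, Option.map_some, ha₂.reg i hi, hv]
  have hr₂ : Rep ((List.range (B + 2)).map u₂.reg) u₂.arr u₂ := by
    refine ⟨fun i v hi => ?_, rfl⟩
    have hlt := (List.getElem?_eq_some_iff.1 hi).1
    rw [List.length_map, List.length_range] at hlt
    rw [List.getElem?_map, List.getElem?_range hlt, Option.map_some, Option.some.injEq] at hi
    exact hi
  have hBn : s₁.reg B = n := hr₁.reg B n (by
    rw [List.getElem?_append_right (by simp; omega)]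
    simp [show B - (B - 1 + 1) = 0 by omega])
  have hBl : s₁.reg (B + 1) = 1 + n * n := hr₁.reg (B + 1) _ (by
    rw [List.getElem?_append_right (by simp)]
    simp [show B + 1 - (B - 1 + 1) = 1 by omega])
  have hrest := Runs.seq (runs_restoreP (O := O) (A := u₂.arr) (B := B) (by omega) (by simp)
    (hreg le_rfl hBn (by omega)) (hreg (by omega) hBl (by omega))) (d := coreP)
    (L' := [1 + n * n])
    (Q := fun A' => (List.range (1 + n * n)).map (A' 0) = (CanGrp G).encode)
    (T₂ := coreTime n) fun A₃ h₃ => by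
      rw [hthr]
      refine runs_coreP hCan hGrp hO hG ?_
      rw [← htab]
      refine List.map_congr_left fun i hi => ?_
      rw [List.mem_range] at hi
      rw [h₃ i hi, ha₂.arr B le_rfl, hr₁.arr, hsave i hi]
  obtain ⟨s₄, t₄, e₄, ⟨A', hA', hq⟩, ht₄⟩ := hrest u₂ hr₂
  exact computesWithin_of_rep (.seq e₁ (.seq e₂' e₄)) hA' hq (by dsimp only; omega)

end GroupCanon

theorem mainTheorem11 :
    -- a solvable group of order `n` has at least one and at most `n` Sylow bases
    (∀ G : TableGroup, Group.IsSolvable G →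
      Nonempty (SylowBasis G) ∧ Nat.card (SylowBasis G) ≤ G.order) ∧
    -- for each threshold and each canonical form of decompositions, the tables of the
    -- lexicographically least forms over all Sylow bases are a canonical form of solvable groups
    (∀ (α : ℕ → ℝ) (Can : TablePair → TablePair), IsCanonicalDecomp α Can →
      (∃ CanGrp : TableGroup → TableGroup, IsLexLeastTable α Can CanGrp) ∧
      ∀ CanGrp : TableGroup → TableGroup, IsLexLeastTable α Can CanGrp →
        IsCanonicalSolvable CanGrp) ∧
    -- one program that is given the value of the threshold works for all thresholds
    (∃ (c : Prog) (q : Polynomial ℕ), ∀ (α : ℕ → ℝ) (Can : TablePair → TablePair)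
      (CanGrp : TableGroup → TableGroup), IsCanonicalDecomp α Can → IsLexLeastTable α Can CanGrp →
        ReducesTo α Can CanGrp (fun n => [threshold α n]) c (fun n => q.eval n)) ∧
    -- if the threshold is computable in polynomial time, then there is a program that is given the
    -- table alone
    (∀ α : ℕ → ℝ, IsPolyTimeThreshold α → ∃ (c : Prog) (q : Polynomial ℕ),
      ∀ (Can : TablePair → TablePair) (CanGrp : TableGroup → TableGroup),
        IsCanonicalDecomp α Can → IsLexLeastTable α Can CanGrp →
          ReducesTo α Can CanGrp (fun _ => []) c (fun n => q.eval n)) := by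
  refine ⟨fun G hG => ⟨nonempty_sylowBasis, ?_⟩, fun α Can hCan =>
    ⟨hCan.exists_isLexLeastTable, fun CanGrp h => h.isCanonicalSolvable hCan⟩, ?_, ?_⟩
  · rw [← G.card_eq]
    exact card_sylowBasis_le
  · obtain ⟨q, hq⟩ := isPolynomialFun_coreTime.add (isPolynomialFun_const 5)
    refine ⟨givenThresholdP, q, fun α Can CanGrp hCan hGrp => ?_⟩
    simp only [hq]
    exact reducesTo_givenThresholdP hCan hGrp
  · rintro α ⟨c, q₀, hc⟩
    have hlen : IsPolynomialFun fun n => 1 + n * n := (isPolynomialFun_const 1).add (isPolynomialFun_id.mul isPolynomialFun_id)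
    have hpoly : ∀ k : ℕ, IsPolynomialFun fun n => ((1 + n * n) * k + 3) + (1 + 1 + 1) + 1 + 1 := fun k =>
      ((((hlen.mul (isPolynomialFun_const k)).add (isPolynomialFun_const 3)).add (isPolynomialFun_const (1 + 1 + 1))).add
        (isPolynomialFun_const 1)).add (isPolynomialFun_const 1)
    obtain ⟨q, hq⟩ := (hpoly (4 + 4)).add (IsPolynomialFun.add ⟨q₀, fun _ => rfl⟩
      ((hpoly (3 + 4)).add isPolynomialFun_coreTime))
    refine ⟨computedThresholdP c, q, fun Can CanGrp hCan hGrp => ?_⟩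
    simp only [hq]
    exact reducesTo_computedThresholdP hc hCan hGrp
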